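/- Computability on represented spaces is understood in the usual sense of type-two computability. A represented space is a set $X$ with a partial surjection $\delta:\subseteq\mathbb{N}^{\mathbb{N}}\to X$, and it carries the final topology of $\delta$. A multivalued map is computable if some oracle machine transforms every name of every point of its domain into a name of some admissible value. $\mathcal{O}(\mathbf X)$ is the space of open sets, where a name of $U$ enumerates a set $W$ of finite words such that, for every name $q$ of a point $x$, $x\in U$ iff $q$ has a prefix in $W$. $\mathcal{K}(\mathbf X)$ is the space of saturated compact sets $K$, represented by $\{U\in\mathcal{O}(\mathbf X)\mid K\subseteq U\}\in\mathcal{O}(\mathcal{O}(\mathbf X))$. $\mathcal{V}(\mathbf X)$ is the space of closed sets $A$ given as overt sets, represented by $\{U\in\mathcal{O}(\mathbf X)\mid A\cap U\neq\emptyset\}\in\mathcal{O}(\mathcal{O}(\mathbf X))$. $(\mathcal{K}\wedge\mathcal{V})(\mathbf X)$ is the space of sets that are both, a name being a pair of a $\mathcal{K}(\mathbf X)$-name and a $\mathcal{V}(\mathbf X)$-name. Let $(X,d)$ be a computable Polish space, i.e. a complete metric space with a dense sequence $(a_n)_{n\in\mathbb{N}}$ such that $(d(a_i,a_j))_{i,j\in\mathbb{N}}$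 is a computable double sequence of real numbers, and let $\mathbf X$ be $X$ with its Cauchy representation (a name of $x$ is a $p\in\mathbb{N}^{\mathbb{N}}$ with $d(a_{p(n)},x)\le 2^{-n}$ for all $n$). Then the following are equivalent: 1. (Effective local compactness by compact-and-overt small closed balls.) Given $x\in\mathbf X$ and a real $\varepsilon>0$, one can compute (as a multivalued map) a closed ball $\overline{B}(x,\rho)=\{y\in X\mid d(x,y)\le\rho\}$ with $\overline{B}(x,\rho)\subseteq B(x,\varepsilon)=\{y\in X\mid d(x,y)<\varepsilon\}$, i.e. its radius $\rho\in\mathbb{R}$, $\rho>0$, together with $\overline{B}(x,\rho)\in(\mathcal{K}\wedge\mathcal{V})(\mathbf X)$; in particular such a ball exists for all $x$ and $\varepsilon$. 2. $\mathbf X$ admits an effective relatively compact system, i.e. there are a computable sequence $(U_n)_{n\in\mathbb{N}}$ in $\mathcal{O}(\mathbf X)$, a computable sequence $(B_n)_{n\in\mathbb{N}}$ in $\mathcal{K}(\mathbf X)$ and a computably enumerable relation $R\subseteq\mathbb{N}\times\mathbb{N}$ such that $(m,n)\in R$ implies $U_m\subseteq B_n$, and such that every open set $U$ satisfies $$U=\bigcup_{\{n\,\mid\,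 U\supseteq B_n\}}\ \bigcup_{\{m\,\mid\,(m,n)\in R\}}U_m .$$ -/

import Mathlib

/-- The finite prefix `p 0, …, p (k-1)` of a point `p` of Baire space. -/
def pre (p : ℕ → ℕ) (k : ℕ) : List ℕ := (List.range k).map p

/-- `Φ` transforms `p` into `q`. Here `Φ w n = some m` reads: having seen only the finite
prefix `w` of the oracle (and within a number of steps bounded by the length of `w`) the
machine has produced `m` as the `n`-th entry of its output. -/
def Transforms (Φ : List ℕ → ℕ → Option ℕ) (p q : ℕ → ℕ) : Prop :=
  ∀ n m, q n = m ↔ ∃ k, Φ (pre p k) n = some m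

/-- A represented space: `X` together with a partial surjection from Baire space onto `X`,
given by its graph. `δ.rel p x` reads: `p` is a name of `x`. -/
structure RepSpace (X : Type*) where
  rel : (ℕ → ℕ) → X → Prop
  functional : ∀ p x y, rel p x → rel p y → x = y
  surj : ∀ x, ∃ p, rel p x

namespace RepSpace

variable {X Y : Type*}

/-- The multivalued map `f : ⊆ X ⇉ Y` with domain `D` is total on `D` and computable: some
machine transforms every name of every `x ∈ D` into a name of some `y ∈ f x`. -/
def ComputableMultiOn (δX : RepSpace X) (δY : RepSpace Y)
    (D : Set X) (f : X → Set Y) : Prop :=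
  ∃ Φ : List ℕ → ℕ → Option ℕ, Computable₂ Φ ∧
    ∀ p x, δX.rel p x → x ∈ D →
      ∃ q y, Transforms Φ p q ∧ δY.rel q y ∧ y ∈ f x

/-- A computable (total, single-valued) map between represented spaces. -/
def ComputableMap (δX : RepSpace X) (δY : RepSpace Y) (f : X → Y) : Prop :=
  ComputableMultiOn δX δY Set.univ (fun x => {f x})

/-- The represented space `ℕ`. -/
def nat : RepSpace ℕ where
  rel p n := p 0 = n
  functional := by
    intro p x y hx hy
    exact hx.symm.trans hy
  surj n := ⟨fun _ => n, rfl⟩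

/-- The product of two represented spaces. -/
def prod (δX : RepSpace X) (δY : RepSpace Y) : RepSpace (X × Y) where
  rel p z := δX.rel (fun n => p (2 * n)) z.1 ∧ δY.rel (fun n => p (2 * n + 1)) z.2
  functional := by
    intro p x y hx hy
    exact Prod.ext (δX.functional _ _ _ hx.1 hy.1) (δY.functional _ _ _ hx.2 hy.2)
  surj := by
    rintro ⟨x, y⟩
    obtain ⟨p, hp⟩ := δX.surj x
    obtain ⟨q, hq⟩ := δY.surj y
    refine ⟨fun n => if n % 2 = 0 then p (n / 2) else q (n / 2), ?_, ?_⟩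
    · have h : (fun n => if (2 * n) % 2 = 0 then p (2 * n / 2) else q (2 * n / 2)) = p := by
        funext n
        have h1 : (2 * n) % 2 = 0 := by omega
        have h2 : 2 * n / 2 = n := by omega
        rw [if_pos h1, h2]
      exact h.symm ▸ hp
    · have h : (fun n => if (2 * n + 1) % 2 = 0 then p ((2 * n + 1) / 2)
          else q ((2 * n + 1) / 2)) = q := by
        funext n
        have h1 : ¬ (2 * n + 1) % 2 = 0 := by omega
        have h2 : (2 * n + 1) / 2 = n := by omega
        rw [if_neg h1, h2]
      exact h.symm ▸ hq

/-- Open sets of a represented space (final topology of the representation): whether a name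
belongs to the preimage of an open set is certified by a finite prefix of that name. -/
def IsOpenSet (δ : RepSpace X) (U : Set X) : Prop :=
  ∀ p x, δ.rel p x → x ∈ U →
    ∃ k, ∀ q y, pre q k = pre p k → δ.rel q y → y ∈ U

/-- The underlying set of the hyperspace `𝒪(X)`. -/
abbrev Opens (δ : RepSpace X) : Type _ := {U : Set X // δ.IsOpenSet U}

/-- `p` enumerates the finite word `w` (the entry `0` enumerates nothing). -/
def Enumerates (p : ℕ → ℕ) (w : List ℕ) : Prop := ∃ i, p i = Encodable.encode w + 1

theorem length_pre (p : ℕ → ℕ) (k : ℕ) : (pre p k).length = k := by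
  simp [pre]

/-- The represented space `𝒪(X)` of open sets: a name of `U` enumerates a set of finite words
such that a name of a point has a prefix among them iff the point lies in `U`
(a name of a realizer of the characteristic function of `U` into Sierpinski space). -/
def opens (δ : RepSpace X) : RepSpace δ.Opens where
  rel p U := ∀ q x, δ.rel q x → (x ∈ U.1 ↔ ∃ k, Enumerates p (pre q k))
  functional := by
    intro p U V hU hV
    apply Subtype.ext
    ext x
    obtain ⟨q, hq⟩ := δ.surj x
    rw [hU q x hq, hV q x hq]
  surj := by
    classical
    rintro ⟨U, hU⟩
    refine ⟨fun i => if ∃ w : List ℕ, Encodable.encode w = i ∧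
      ∀ q y, pre q w.length = w → δ.rel q y → y ∈ U then i + 1 else 0, ?_⟩
    intro q x hq
    constructor
    · intro hx
      obtain ⟨k, hk⟩ := hU q x hq hx
      refine ⟨k, Encodable.encode (pre q k), ?_⟩
      refine if_pos ⟨pre q k, rfl, ?_⟩
      intro q' y h hy
      rw [length_pre] at h
      exact hk q' y h hy
    · rintro ⟨k, i, hi⟩
      dsimp only at hi
      split_ifs at hi with h
      · obtain ⟨w, hw, h'⟩ := h
        have : w = pre q k := Encodable.encode_injective (by omega)
        subst this
        exact h' q x (by rw [length_pre]) hq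

/-- Closed sets of a represented space. -/
def IsClosedSet (δ : RepSpace X) (A : Set X) : Prop := δ.IsOpenSet Aᶜ

/-- Saturated sets: the intersections of open sets. -/
def IsSaturated (δ : RepSpace X) (K : Set X) : Prop :=
  ∀ x, (∀ U : δ.Opens, K ⊆ U.1 → x ∈ U.1) → x ∈ K

/-- Compact sets of a represented space: the set `{U | K ⊆ U}` is an open subset of `𝒪(X)`. -/
def IsCompactSet (δ : RepSpace X) (K : Set X) : Prop :=
  δ.opens.IsOpenSet {U | K ⊆ U.1}

/-- The underlying set of the hyperspace `𝒦(X)`: the saturated compact sets (in a `T₁` space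
every set is saturated). -/
abbrev Compacts (δ : RepSpace X) : Type _ :=
  {K : Set X // δ.IsSaturated K ∧ δ.IsCompactSet K}

/-- The represented space `𝒦(X)`: a name of `K` is a name of `{U | K ⊆ U}` in `𝒪(𝒪(X))`. -/
def compacts (δ : RepSpace X) : RepSpace δ.Compacts where
  rel p K := δ.opens.opens.rel p ⟨{U | K.1 ⊆ U.1}, K.2.2⟩
  functional := by
    have key : ∀ (p : ℕ → ℕ) (K L : δ.Compacts),
        δ.opens.opens.rel p ⟨{U | K.1 ⊆ U.1}, K.2.2⟩ →
        δ.opens.opens.rel p ⟨{U | L.1 ⊆ U.1}, L.2.2⟩ → K.1 ⊆ L.1 := by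
      intro p K L hK hL x hx
      have h := congrArg Subtype.val (δ.opens.opens.functional _ _ _ hK hL)
      refine L.2.1 x fun U hU => ?_
      have hU' : U ∈ {U : δ.Opens | K.1 ⊆ U.1} := by
        rw [show {U : δ.Opens | K.1 ⊆ U.1} = {U | L.1 ⊆ U.1} from h]
        exact hU
      exact hU' hx
    intro p K L hK hL
    exact Subtype.ext (Set.Subset.antisymm (key p K L hK hL) (key p L K hL hK))
  surj K := δ.opens.opens.surj _

theorem isOpenSet_meets (δ : RepSpace X) (A : Set X) :
    δ.opens.IsOpenSet {U | (A ∩ U.1).Nonempty} := by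
  rintro p U hp ⟨x, hxA, hxU⟩
  obtain ⟨q, hq⟩ := δ.surj x
  obtain ⟨k, i, hi⟩ := (hp q x hq).1 hxU
  refine ⟨i + 1, fun p' V hpre hV => ⟨x, hxA, (hV q x hq).2 ⟨k, i, ?_⟩⟩⟩
  have h : p' i = p i := by
    have := congrArg (fun l : List ℕ => l[i]?) hpre
    simpa [pre] using this
  rw [h, hi]

/-- The underlying set of the hyperspace `𝒱(X)` of overt sets: the closed sets. -/
abbrev Overts (δ : RepSpace X) : Type _ := {A : Set X // δ.IsClosedSet A}

/-- The represented space `𝒱(X)`: a name of `A` is a name of `{U | A ∩ U ≠ ∅}`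
in `𝒪(𝒪(X))`. -/
def overts (δ : RepSpace X) : RepSpace δ.Overts where
  rel p A := δ.opens.opens.rel p ⟨{U | (A.1 ∩ U.1).Nonempty}, δ.isOpenSet_meets A.1⟩
  functional := by
    have key : ∀ (p : ℕ → ℕ) (A B : δ.Overts),
        δ.opens.opens.rel p ⟨{U | (A.1 ∩ U.1).Nonempty}, δ.isOpenSet_meets A.1⟩ →
        δ.opens.opens.rel p ⟨{U | (B.1 ∩ U.1).Nonempty}, δ.isOpenSet_meets B.1⟩ →
        A.1 ⊆ B.1 := by
      intro p A B hA hB x hx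
      have h := congrArg Subtype.val (δ.opens.opens.functional _ _ _ hA hB)
      by_contra hxB
      have hU : (⟨B.1ᶜ, B.2⟩ : δ.Opens) ∈ {U : δ.Opens | (A.1 ∩ U.1).Nonempty} :=
        ⟨x, hx, hxB⟩
      rw [show {U : δ.Opens | (A.1 ∩ U.1).Nonempty} = {U | (B.1 ∩ U.1).Nonempty} from h] at hU
      obtain ⟨y, hy, hy'⟩ := hU
      exact hy' hy
    intro p A B hA hB
    exact Subtype.ext (Set.Subset.antisymm (key p A B hA hB) (key p B A hB hA))
  surj A := δ.opens.opens.surj _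

/-- The underlying set of `(𝒦 ∧ 𝒱)(X)`. -/
abbrev CompactOverts (δ : RepSpace X) : Type _ :=
  {K : Set X // (δ.IsSaturated K ∧ δ.IsCompactSet K) ∧ δ.IsClosedSet K}

/-- The represented space `(𝒦 ∧ 𝒱)(X)` of compact-and-overt sets: a name of `K` is a pair of
a name of `K` in `𝒦(X)` and a name of `K` in `𝒱(X)`. -/
def compactOverts (δ : RepSpace X) : RepSpace δ.CompactOverts where
  rel p K := (δ.compacts.prod δ.overts).rel p (⟨K.1, K.2.1⟩, ⟨K.1, K.2.2⟩)
  functional := by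
    intro p K L hK hL
    have h := (δ.compacts.prod δ.overts).functional _ _ _ hK hL
    exact Subtype.ext (congrArg (fun z : δ.Compacts × δ.Overts => z.1.1) h)
  surj K := (δ.compacts.prod δ.overts).surj _

/-- Effective relatively compact systems of a represented space. -/
structure IsErcs (δ : RepSpace X) (U : ℕ → δ.Opens) (B : ℕ → δ.Compacts)
    (R : Set (ℕ × ℕ)) : Prop where
  computable_opens : ComputableMap nat δ.opens U
  computable_compacts : ComputableMap nat δ.compacts B
  ce : REPred (fun mn : ℕ × ℕ => mn ∈ R)
  subset_of_mem : ∀ m n, (m, n) ∈ R → (U m).1 ⊆ (B n).1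
  eq_iUnion : ∀ W : δ.Opens,
    W.1 = ⋃ n ∈ {n | (B n).1 ⊆ W.1}, ⋃ m ∈ {m | (m, n) ∈ R}, (U m).1

/-- The represented space admits an ercs. -/
def AdmitsErcs (δ : RepSpace X) : Prop := ∃ U B R, δ.IsErcs U B R

/-- The Cauchy representation for a dense sequence `a` of a metric space: a name of `x` is a
sequence of indices `p` such that `a (p n)` has distance at most `2⁻ⁿ` to `x`. -/
def cauchy [MetricSpace X] (a : ℕ → X) (ha : DenseRange a) : RepSpace X where
  rel p x := ∀ n, dist (a (p n)) x ≤ (1 / 2 : ℝ) ^ n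
  functional := by
    intro p x y hx hy
    have hlim : Filter.Tendsto (fun n : ℕ => (1 / 2 : ℝ) ^ n) Filter.atTop (nhds 0) :=
      tendsto_pow_atTop_nhds_zero_of_lt_one (by norm_num) (by norm_num)
    have h1 : Filter.Tendsto (fun n => a (p n)) Filter.atTop (nhds x) :=
      tendsto_iff_dist_tendsto_zero.2 (squeeze_zero (fun _ => dist_nonneg) hx hlim)
    have h2 : Filter.Tendsto (fun n => a (p n)) Filter.atTop (nhds y) :=
      tendsto_iff_dist_tendsto_zero.2 (squeeze_zero (fun _ => dist_nonneg) hy hlim)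
    exact tendsto_nhds_unique h1 h2
  surj x := by
    have h : ∀ n : ℕ, ∃ i, dist (a i) x ≤ (1 / 2 : ℝ) ^ n := fun n => by
      obtain ⟨i, hi⟩ := ha.exists_dist_lt x (ε := (1 / 2 : ℝ) ^ n) (by positivity)
      exact ⟨i, by rw [dist_comm]; exact hi.le⟩
    choose p hp using h
    exact ⟨p, hp⟩

end RepSpace

/-- A numbering of the rational numbers (as real numbers). -/
noncomputable def ratNum (n : ℕ) : ℝ :=
  ((n.unpair.1.unpair.1 : ℝ) - (n.unpair.1.unpair.2 : ℝ)) / ((n.unpair.2 : ℝ) + 1)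

theorem range_ratNum (r : ℚ) : ∃ n, ratNum n = (r : ℝ) := by
  refine ⟨Nat.pair (Nat.pair r.num.toNat (-r.num).toNat) (r.den - 1), ?_⟩
  have hd : ((r.den - 1 : ℕ) : ℝ) + 1 = (r.den : ℝ) := by
    have : r.den - 1 + 1 = r.den := Nat.sub_add_cancel r.pos
    exact_mod_cast this
  have hn : ((r.num.toNat : ℕ) : ℝ) - (((-r.num).toNat : ℕ) : ℝ) = (r.num : ℝ) := by
    have : ((r.num.toNat : ℕ) : ℤ) - (((-r.num).toNat : ℕ) : ℤ) = r.num := by omega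
    exact_mod_cast this
  simp only [ratNum, Nat.unpair_pair]
  rw [hd, hn]
  exact (Rat.cast_def r).symm

theorem denseRange_ratNum : DenseRange ratNum := by
  refine Dense.mono ?_ (Rat.denseRange_cast (𝕜 := ℝ))
  rintro _ ⟨r, rfl⟩
  exact range_ratNum r

/-- The represented space `ℝ`. -/
noncomputable def RepSpace.real : RepSpace ℝ :=
  RepSpace.cauchy ratNum denseRange_ratNum

/-- The data making a metric space a computable metric space: a dense sequence whose mutual
distances form a computable double sequence of real numbers. A computable Polish space is a
computable metric space whose metric is complete. -/
structure ComputableMetricStructure (X : Type*) [MetricSpace X] where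
  a : ℕ → X
  dense : DenseRange a
  computable_dist : ∃ f : ℕ × ℕ × ℕ → ℕ, Computable f ∧
    ∀ i j k, |ratNum (f (i, j, k)) - dist (a i) (a j)| ≤ (1 / 2 : ℝ) ^ k

namespace ComputableMetricStructure

variable {X : Type*} [MetricSpace X]

/-- A computable metric space as a represented space. -/
def rep (S : ComputableMetricStructure X) : RepSpace X :=
  RepSpace.cauchy S.a S.dense

/-- Effective local compactness through small balls: given `x ∈ X` and a real `ε > 0` one can
compute a closed ball of positive radius around `x`, that is, its radius `ρ` and the ball
as an element of `(𝒦 ∧ 𝒱)(X)`, which is contained in the open ball `B(x, ε)`. -/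
def EffectivelyLocallyCompactBalls (S : ComputableMetricStructure X) : Prop :=
  RepSpace.ComputableMultiOn (S.rep.prod RepSpace.real)
    (S.rep.compactOverts.prod RepSpace.real)
    {z | 0 < z.2}
    (fun z => {w | 0 < w.2 ∧ w.1.1 = Metric.closedBall z.1 w.2 ∧
      w.1.1 ⊆ Metric.ball z.1 z.2})

end ComputableMetricStructure

-- Balls to system: run the given machine on names of the dense points `a i`, with precision `2⁻ᵏ`.
-- An index carries `i`, `k` and a finite word `w` with which the name of `a i` starts; `B n` is the
-- closed ball produced, `U n` the open ball of the same radius and `R` the diagonal. The word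
-- matters because the radius may depend on the name, so the radii at dense points near `x` could
-- shrink to zero. If instead the machine runs on a name of `x`, it fixes a useful lower bound for
-- the radius after a finite prefix. A dense point sufficiently close to `x` has a name with that
-- prefix, receives the same bound, and its ball contains `x`.
--
-- System to balls: search for `n` and `k` such that the closed ball of radius `2⁻ᵏ` around `x` lies
-- in some `U m ⊆ B n`, and `B n ⊆ B(x, ε)`. A closed ball of any computable radius `ρ ≤ 2⁻ᵏ` is
-- then computably compact: it lies in `V` iff finitely many rational balls cover `B n`, each of
-- them visibly outside the ball or inside `V`. Overtness is the difficulty, since a closed ball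
-- need not be the closure of the open ball. The radius is therefore built by nested intervals. At
-- each stage the interval is shrunk so that either a dense point near a given `a e` lies strictly
-- within the lower radius, or the ball of the upper radius visibly avoids a slightly smaller
-- neighbourhood of `a e` (`exists_refines`). For the limit radius, every open set meeting the
-- closed ball contains a dense point of the open ball (`isRadiusApprox_of_refines`), and such
-- points can be enumerated.
--
-- All algorithms are phrased as semidecidable relations relative to a family of oracles, `SemiDec`.
-- A true existential statement can be searched for (`SemiDec.choose`), the search can be iterated
-- (`OComp.iterate`), and the result is a single machine (`OComp.exists_transforms`). The link to
-- topology is `exists_finite_subcover`.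

attribute [fun_prop] Primrec
attribute [fun_prop] Primrec.id Primrec.const Primrec.comp Primrec.pair Primrec.fst Primrec.snd
  Primrec.succ Primrec.pred Primrec.unpair Primrec.encode Primrec.decode Primrec.option_some
  Primrec.list_range Primrec.list_length

/-! ### Primitive recursive functions and predicates -/

section PrimrecLemmas

variable {α β γ : Type*} [Primcodable α] [Primcodable β] [Primcodable γ]

namespace Primrec

@[fun_prop]
theorem fun_add {f g : α → ℕ} (hf : Primrec f) (hg : Primrec g) : Primrec fun a => f a + g a :=
  nat_add.comp hf hg

@[fun_prop]
theorem fun_sub {f g : α → ℕ} (hf : Primrec f) (hg : Primrec g) : Primrec fun a => f a - g a :=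
  nat_sub.comp hf hg

@[fun_prop]
theorem fun_mul {f g : α → ℕ} (hf : Primrec f) (hg : Primrec g) : Primrec fun a => f a * g a :=
  nat_mul.comp hf hg

@[fun_prop]
theorem fun_div {f g : α → ℕ} (hf : Primrec f) (hg : Primrec g) : Primrec fun a => f a / g a :=
  nat_div.comp hf hg

@[fun_prop]
theorem fun_mod {f g : α → ℕ} (hf : Primrec f) (hg : Primrec g) : Primrec fun a => f a % g a :=
  nat_mod.comp hf hg

@[fun_prop]
theorem fun_natPair {f g : α → ℕ} (hf : Primrec f) (hg : Primrec g) :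
    Primrec fun a => Nat.pair (f a) (g a) :=
  Primrec₂.natPair.comp hf hg

@[fun_prop]
theorem fun_pow {f g : α → ℕ} (hf : Primrec f) (hg : Primrec g) : Primrec fun a => f a ^ g a :=
  (Primrec₂.unpaired'.1 Nat.Primrec.pow).comp hf hg

@[fun_prop]
theorem fun_take {f : α → ℕ} {g : α → List β} (hf : Primrec f) (hg : Primrec g) :
    Primrec fun a => (g a).take (f a) :=
  list_take.comp hf hg

@[fun_prop]
theorem fun_getElem? {f : α → ℕ} {g : α → List β} (hf : Primrec f) (hg : Primrec g) :
    Primrec fun a => (g a)[f a]? :=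
  list_getElem?.comp hg hf

@[fun_prop]
theorem fun_getD {f : α → ℕ} {g : α → List β} {d : α → β} (hf : Primrec f) (hg : Primrec g)
    (hd : Primrec d) : Primrec fun a => (g a).getD (f a) (d a) :=
  (option_getD.comp (list_getElem?.comp hg hf) hd).of_eq fun _ => by simp [List.getD]

@[fun_prop]
theorem fun_optionGetD {f : α → Option β} {d : α → β} (hf : Primrec f) (hd : Primrec d) :
    Primrec fun a => (f a).getD (d a) :=
  option_getD.comp hf hd

theorem fun_listMap {f : α → List β} {g : α → β → γ} (hf : Primrec f)
    (hg : Primrec fun z : α × β => g z.1 z.2) : Primrec fun a => (f a).map (g a) :=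
  list_map hf hg

theorem fun_pre {f : α → ℕ} {p : α → ℕ → ℕ} (hf : Primrec f)
    (hp : Primrec fun z : α × ℕ => p z.1 z.2) : Primrec fun a => pre (p a) (f a) :=
  fun_listMap (list_range.comp hf) hp

end Primrec

namespace PrimrecPred

theorem eq_fun {f g : α → β} (hf : Primrec f) (hg : Primrec g) : PrimrecPred fun a => f a = g a :=
  Primrec.eq.comp hf hg

theorem lt_fun {f g : α → ℕ} (hf : Primrec f) (hg : Primrec g) : PrimrecPred fun a => f a < g a :=
  Primrec.nat_lt.comp hf hg

theorem le_fun {f g : α → ℕ} (hf : Primrec f) (hg : Primrec g) : PrimrecPred fun a => f a ≤ g a :=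
  Primrec.nat_le.comp hf hg

theorem exists_option {f : α → Option β} (hf : Primrec f) {R : α → β → Prop}
    (hR : PrimrecPred fun z : α × β => R z.1 z.2) :
    PrimrecPred fun a => ∃ b, f a = some b ∧ R a b := by
  classical
  have h : Primrec fun a => (f a).map fun b => decide (R a b) :=
    Primrec.option_map hf (g := fun a b => decide (R a b)) hR.decide
  refine (eq_fun h (Primrec.const (some true))).of_eq fun a => ?_
  simp

theorem exists_lt_fun {f : α → ℕ} (hf : Primrec f) {R : α → ℕ → Prop}
    (hR : PrimrecPred fun z : α × ℕ => R z.1 z.2) :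
    PrimrecPred fun a => ∃ n < f a, R a n := by
  have h : PrimrecRel fun (n : ℕ) (a : α) => R a n :=
    hR.comp (f := fun z : ℕ × α => (z.2, z.1)) (by fun_prop)
  exact (h.exists_mem_list.comp (f := fun a => List.range (f a)) (by fun_prop) Primrec.id).of_eq
    fun a => by simp

theorem forall_mem_fun {f : α → List β} (hf : Primrec f) {R : α → β → Prop}
    (hR : PrimrecPred fun z : α × β => R z.1 z.2) :
    PrimrecPred fun a => ∀ b ∈ f a, R a b := by
  have h : PrimrecRel fun (b : β) (a : α) => R a b :=
    hR.comp (f := fun z : β × α => (z.2, z.1)) (by fun_prop)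
  exact h.forall_mem_list.comp hf Primrec.id

theorem mem_list {f : α → β} {g : α → List β} (hf : Primrec f) (hg : Primrec g) :
    PrimrecPred fun a => f a ∈ g a := by
  have h : PrimrecRel fun (b : β) (a : β) => a = b :=
    PrimrecPred.comp Primrec.eq (f := fun z : β × β => (z.2, z.1)) (by fun_prop)
  refine (h.exists_mem_list.comp hg hf).of_eq fun a => ?_
  simp

end PrimrecPred

end PrimrecLemmas

/-! ### Finite prefixes of sequences -/

theorem pre_take (p : ℕ → ℕ) (k K : ℕ) : (pre p K).take k = pre p (min k K) := by
  simp [pre, ← List.map_take, List.take_range]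

theorem getD_pre (p : ℕ → ℕ) {j k : ℕ} (h : j < k) (d : ℕ) : (pre p k).getD j d = p j := by
  simp [pre, h]

theorem pre_congr {p q : ℕ → ℕ} {k : ℕ} (h : ∀ j < k, p j = q j) : pre p k = pre q k := by
  refine List.map_congr_left fun j hj => h j (List.mem_range.1 hj)

theorem pre_eq_iff {p : ℕ → ℕ} {w : List ℕ} {k : ℕ} :
    pre p k = w ↔ w.length = k ∧ ∀ j < k, w.getD j 0 = p j := by
  constructor
  · rintro rfl
    exact ⟨RepSpace.length_pre p k, fun j hj => getD_pre p hj 0⟩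
  · rintro ⟨h, h'⟩
    refine List.ext_getElem (by rw [RepSpace.length_pre, h]) fun j hj hj' => ?_
    have := h' j (by omega)
    simp only [List.getD_eq_getElem?_getD, List.getElem?_eq_getElem hj', Option.getD_some] at this
    simp [pre, this]

theorem apply_eq_of_pre_eq {p q : ℕ → ℕ} {k j : ℕ} (h : pre p k = pre q k) (hj : j < k) :
    p j = q j := by
  rw [← getD_pre p hj 0, h, getD_pre q hj 0]

/-! ### Semidecidability and computability relative to oracles -/

/-- The family `A` of predicates is uniformly semidecidable relative to the family `o` of
oracles. -/
def SemiDec {ι α : Type*} [Primcodable α] (o : ι → ℕ → ℕ) (A : ι → α → Prop) : Prop :=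
  ∃ T : List ℕ → α → Prop, PrimrecPred (fun z : List ℕ × α => T z.1 z.2) ∧
    ∀ i a, A i a ↔ ∃ k, T (pre (o i) k) a

/-- The family `q` of functions is uniformly computable relative to the family `o` of oracles. -/
def OComp {ι α β : Type*} [Primcodable α] [Primcodable β] (o : ι → ℕ → ℕ)
    (q : ι → α → β) : Prop :=
  SemiDec o fun i (z : α × β) => q i z.1 = z.2

section SemiDec

variable {ι α β γ : Type*} [Primcodable α] [Primcodable β] [Primcodable γ] {o : ι → ℕ → ℕ}

namespace SemiDec

theorem of_eq {A B : ι → α → Prop} (h : SemiDec o A) (H : ∀ i a, A i a ↔ B i a) :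
    SemiDec o B := by
  obtain rfl : A = B := funext fun i => funext fun a => propext (H i a)
  exact h

/-- Trying the test on all prefixes of what has been read makes acceptance permanent, so that
several tests can be synchronised at the maximum of their prefix lengths. -/
theorem exists_mono {A : ι → α → Prop} (h : SemiDec o A) :
    ∃ T : List ℕ → α → Prop, PrimrecPred (fun z : List ℕ × α => T z.1 z.2) ∧
      (∀ i a, A i a ↔ ∃ k, T (pre (o i) k) a) ∧
      ∀ i a k K, k ≤ K → T (pre (o i) k) a → T (pre (o i) K) a := by
  obtain ⟨T, hT, hA⟩ := h
  refine ⟨fun w a => ∃ k < w.length + 1, T (w.take k) a, ?_, fun i a => ?_, ?_⟩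
  · refine PrimrecPred.exists_lt_fun
      (R := fun (z : List ℕ × α) (k : ℕ) => T (z.1.take k) z.2) (by fun_prop) ?_
    exact hT.comp (f := fun z : (List ℕ × α) × ℕ => (z.1.1.take z.2, z.1.2)) (by fun_prop)
  · rw [hA]
    constructor
    · rintro ⟨k, hk⟩
      exact ⟨k, k, by rw [RepSpace.length_pre]; omega, by rwa [pre_take, min_self]⟩
    · rintro ⟨K, k, -, h⟩
      rw [pre_take] at h
      exact ⟨_, h⟩
  · rintro i a k K hkK ⟨j, hj, h⟩
    rw [RepSpace.length_pre] at hj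
    refine ⟨j, by rw [RepSpace.length_pre]; omega, ?_⟩
    rw [pre_take] at h ⊢
    rwa [min_eq_left (by omega)] at h ⊢

theorem of_primrecPred {Q : α → Prop} (h : PrimrecPred Q) : SemiDec o fun _ a => Q a :=
  ⟨fun _ a => Q a, h.comp Primrec.snd, fun _ _ => by simp⟩

/-- The length of the prefix serves as the step bound of the computation; its entries are ignored.
-/
theorem of_re {Q : α → Prop} (h : REPred Q) : SemiDec o fun _ a => Q a := by
  obtain ⟨c, hc⟩ := Nat.Partrec.Code.exists_code.1 h
  refine ⟨fun w a => (Nat.Partrec.Code.evaln w.length c (Encodable.encode a)).isSome = true,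
    ?_, fun i a => ?_⟩
  · refine PrimrecPred.eq_fun (Primrec.option_isSome.comp
      (Nat.Partrec.Code.primrec_evaln.comp (f := fun a : (ℕ × Nat.Partrec.Code) × ℕ =>
        Nat.Partrec.Code.evaln a.1.1 a.1.2 a.2)
        (g := fun z : List ℕ × α => ((z.1.length, c), Encodable.encode z.2)) (by fun_prop)))
      (Primrec.const true)
  · have h1 : Q a ↔ (Nat.Partrec.Code.eval c (Encodable.encode a)).Dom := by
      rw [hc]
      simp [Part.assert]
    dsimp only
    rw [h1, Part.dom_iff_mem]
    simp only [Nat.Partrec.Code.evaln_complete, Option.isSome_iff_exists, RepSpace.length_pre,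
      Option.mem_def]
    exact exists_comm

theorem comp {A : ι → β → Prop} (h : SemiDec o A) {f : α → β} (hf : Primrec f) :
    SemiDec o fun i a => A i (f a) := by
  obtain ⟨T, hT, hA⟩ := h
  exact ⟨fun w a => T w (f a), hT.comp (f := fun z : List ℕ × α => (z.1, f z.2)) (by fun_prop),
    fun i a => hA i (f a)⟩

theorem and {A B : ι → α → Prop} (hA : SemiDec o A) (hB : SemiDec o B) :
    SemiDec o fun i a => A i a ∧ B i a := by
  obtain ⟨T, hT, hTA, hTm⟩ := hA.exists_mono
  obtain ⟨S, hS, hSB, hSm⟩ := hB.exists_mono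
  refine ⟨fun w a => T w a ∧ S w a, hT.and hS, fun i a => ?_⟩
  dsimp only
  rw [hTA, hSB]
  constructor
  · rintro ⟨⟨k, hk⟩, l, hl⟩
    exact ⟨max k l, hTm _ _ _ _ (le_max_left _ _) hk, hSm _ _ _ _ (le_max_right _ _) hl⟩
  · rintro ⟨k, h1, h2⟩
    exact ⟨⟨k, h1⟩, k, h2⟩

theorem or {A B : ι → α → Prop} (hA : SemiDec o A) (hB : SemiDec o B) :
    SemiDec o fun i a => A i a ∨ B i a := by
  obtain ⟨T, hT, hTA⟩ := hA
  obtain ⟨S, hS, hSB⟩ := hB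
  refine ⟨fun w a => T w a ∨ S w a, hT.or hS, fun i a => ?_⟩
  dsimp only
  rw [hTA, hSB, exists_or]

/-- Dovetailing: the length of the prefix also bounds the code of the witness. -/
theorem ex {A : ι → α → β → Prop} (h : SemiDec o fun i (z : α × β) => A i z.1 z.2) :
    SemiDec o fun i a => ∃ b, A i a b := by
  obtain ⟨T, hT, hA, hm⟩ := h.exists_mono
  refine ⟨fun w a => ∃ n < w.length, ∃ b, Encodable.decode n = some b ∧ T w (a, b), ?_,
    fun i a => ?_⟩
  · refine PrimrecPred.exists_lt_fun (R := fun (z : List ℕ × α) (n : ℕ) =>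
      ∃ b, Encodable.decode n = some b ∧ T z.1 (z.2, b)) (by fun_prop) ?_
    refine PrimrecPred.exists_option (f := fun z : (List ℕ × α) × ℕ => Encodable.decode z.2)
      (R := fun (z : (List ℕ × α) × ℕ) (b : β) => T z.1.1 (z.1.2, b)) (by fun_prop) ?_
    exact hT.comp (f := fun z : ((List ℕ × α) × ℕ) × β => (z.1.1.1, (z.1.1.2, z.2)))
      (by fun_prop)
  · constructor
    · rintro ⟨b, hb⟩
      obtain ⟨k, hk⟩ := (hA i (a, b)).1 hb
      refine ⟨max k (Encodable.encode b + 1), Encodable.encode b, ?_, b, Encodable.encodek b,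
        hm _ _ _ _ (le_max_left _ _) hk⟩
      rw [RepSpace.length_pre]
      exact lt_of_lt_of_le (Nat.lt_succ_self _) (le_max_right _ _)
    · rintro ⟨k, n, -, b, -, h⟩
      exact ⟨b, (hA i (a, b)).2 ⟨k, h⟩⟩

theorem forall_mem {l : α → List β} (hl : Primrec l) {A : ι → α → β → Prop}
    (h : SemiDec o fun i (z : α × β) => A i z.1 z.2) :
    SemiDec o fun i a => ∀ b ∈ l a, A i a b := by
  obtain ⟨T, hT, hA, hm⟩ := h.exists_mono
  refine ⟨fun w a => ∀ b ∈ l a, T w (a, b), ?_, fun i a => ?_⟩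
  · refine PrimrecPred.forall_mem_fun (f := fun z : List ℕ × α => l z.2)
      (R := fun (z : List ℕ × α) (b : β) => T z.1 (z.2, b)) (by fun_prop) ?_
    exact hT.comp (f := fun z : (List ℕ × α) × β => (z.1.1, (z.1.2, z.2))) (by fun_prop)
  · constructor
    · intro hall
      have : ∀ l' : List β, (∀ b ∈ l', A i a b) → ∃ k, ∀ b ∈ l', T (pre (o i) k) (a, b) := by
        intro l'
        induction l' with
        | nil => exact fun _ => ⟨0, by simp⟩
        | cons c l' ih =>
          intro hc
          obtain ⟨k, hk⟩ := ih fun b hb => hc b (List.mem_cons_of_mem _ hb)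
          obtain ⟨k', hk'⟩ := (hA i (a, c)).1 (hc c List.mem_cons_self)
          refine ⟨max k k', fun b hb => ?_⟩
          rcases List.mem_cons.1 hb with rfl | hb
          · exact hm _ _ _ _ (le_max_right _ _) hk'
          · exact hm _ _ _ _ (le_max_left _ _) (hk b hb)
      exact this _ hall
    · rintro ⟨k, hk⟩ b hb
      exact (hA i (a, b)).2 ⟨k, hk b hb⟩

theorem forall_lt {f : α → ℕ} (hf : Primrec f) {A : ι → α → ℕ → Prop}
    (h : SemiDec o fun i (z : α × ℕ) => A i z.1 z.2) :
    SemiDec o fun i a => ∀ n < f a, A i a n :=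
  (forall_mem (Primrec.list_range.comp hf) h).of_eq fun i a => by simp

/-- A primitive recursive condition on a prefix of the oracle of known length. -/
theorem of_pre {T : List ℕ → α → Prop} (hT : PrimrecPred fun z : List ℕ × α => T z.1 z.2)
    {g : α → ℕ} (hg : Primrec g) : SemiDec o fun i a => T (pre (o i) (g a)) a := by
  refine ⟨fun w a => g a ≤ w.length ∧ T (w.take (g a)) a, ?_, fun i a => ?_⟩
  · refine (PrimrecPred.le_fun (by fun_prop) (by fun_prop)).and ?_
    exact hT.comp (f := fun z : List ℕ × α => (z.1.take (g z.2), z.2)) (by fun_prop)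
  · constructor
    · exact fun h => ⟨g a, by rw [RepSpace.length_pre], by rwa [pre_take, min_self]⟩
    · rintro ⟨k, hk, h⟩
      rw [RepSpace.length_pre] at hk
      rwa [pre_take, min_eq_left hk] at h

theorem subst {q : ι → α → β} (hq : OComp o q) {A : ι → α → β → Prop}
    (h : SemiDec o fun i (z : α × β) => A i z.1 z.2) : SemiDec o fun i a => A i a (q i a) :=
  (ex (A := fun i a b => q i a = b ∧ A i a b) (hq.and h)).of_eq fun i a => by simp

/-- Search for the least code `c` of a pair (prefix length, value) that passes the test. Each single
trial reads a prefix of known length and so is decidable relative to the oracle; hence minimality of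
`c`, and with it the graph of the chosen function, is semidecidable. -/
theorem choose {A : ι → α → β → Prop} (h : SemiDec o fun i (z : α × β) => A i z.1 z.2)
    (hA : ∀ i a, ∃ b, A i a b) : ∃ q : ι → α → β, OComp o q ∧ ∀ i a, A i a (q i a) := by
  classical
  obtain ⟨T, hT, hTA⟩ := h
  let Q : List ℕ → α × ℕ → Prop := fun w z =>
    ∃ b, (Encodable.decode z.2.unpair.2 : Option β) = some b ∧ T w (z.1, b)
  have hQ : PrimrecPred fun z : List ℕ × (α × ℕ) => Q z.1 z.2 := by
    refine PrimrecPred.exists_option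
      (f := fun z : List ℕ × (α × ℕ) => (Encodable.decode z.2.2.unpair.2 : Option β))
      (R := fun (z : List ℕ × (α × ℕ)) (b : β) => T z.1 (z.2.1, b)) (by fun_prop) ?_
    exact hT.comp (f := fun z : (List ℕ × (α × ℕ)) × β => (z.1.1, (z.1.2.1, z.2))) (by fun_prop)
  have hex : ∀ i a, ∃ c : ℕ, Q (pre (o i) c.unpair.1) (a, c) := fun i a => by
    obtain ⟨b, hb⟩ := hA i a
    obtain ⟨k, hk⟩ := (hTA i (a, b)).1 hb
    exact ⟨Nat.pair k (Encodable.encode b), b, by simp, by simpa using hk⟩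
  choose q hq using fun i a => Nat.find_spec (hex i a)
  refine ⟨q, ?_, fun i a => (hTA i (a, q i a)).2 ⟨_, (hq i a).2⟩⟩
  have key : SemiDec o fun i (z : α × β) => ∃ c : ℕ,
      (Encodable.decode c.unpair.2 = some z.2 ∧ Q (pre (o i) c.unpair.1) (z.1, c)) ∧
        ∀ c' < c, ¬ Q (pre (o i) c'.unpair.1) (z.1, c') := by
    refine ex (A := fun i (z : α × β) (c : ℕ) =>
      (Encodable.decode c.unpair.2 = some z.2 ∧ Q (pre (o i) c.unpair.1) (z.1, c)) ∧
        ∀ c' < c, ¬ Q (pre (o i) c'.unpair.1) (z.1, c')) (and (and ?_ ?_) ?_)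
    · exact of_primrecPred (PrimrecPred.eq_fun (by fun_prop) (by fun_prop))
    · exact of_pre (T := fun w (z : (α × β) × ℕ) => Q w (z.1.1, z.2))
        (hQ.comp (f := fun z : List ℕ × ((α × β) × ℕ) => (z.1, (z.2.1.1, z.2.2))) (by fun_prop))
        (by fun_prop)
    · refine forall_lt (A := fun i (z : (α × β) × ℕ) (c' : ℕ) =>
        ¬ Q (pre (o i) c'.unpair.1) (z.1.1, c')) (by fun_prop) ?_
      exact of_pre (T := fun w (z : ((α × β) × ℕ) × ℕ) => ¬ Q w (z.1.1.1, z.2))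
        (hQ.comp (f := fun z : List ℕ × (((α × β) × ℕ) × ℕ) => (z.1, (z.2.1.1.1, z.2.2)))
          (by fun_prop)).not (by fun_prop)
  refine key.of_eq fun i z => ?_
  constructor
  · rintro ⟨c, ⟨h1, h2⟩, h3⟩
    have hc : Nat.find (hex i z.1) = c := by
      refine le_antisymm (Nat.find_min' _ h2) ?_
      by_contra! hlt
      exact h3 _ hlt (Nat.find_spec (hex i z.1))
    have := (hq i z.1).1
    simp only [hc, h1, Option.some.injEq] at this
    exact this.symm
  · rintro hz
    refine ⟨Nat.find (hex i z.1), ⟨hz ▸ (hq i z.1).1, Nat.find_spec (hex i z.1)⟩,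
      fun c' hc' => Nat.find_min _ hc'⟩

end SemiDec

namespace OComp

theorem of_primrec {f : α → β} (hf : Primrec f) : OComp o fun _ => f :=
  SemiDec.of_primrecPred (PrimrecPred.eq_fun (by fun_prop) (by fun_prop))

theorem of_computable {f : α → β} (hf : Computable f) : OComp o fun _ => f := by
  classical
  refine SemiDec.of_re (ComputablePred.to_re ⟨inferInstance, ?_⟩)
  exact (Primrec.eq (α := β)).decide.to_comp.comp (hf.comp Computable.fst) Computable.snd

theorem comp {q : ι → β → γ} (hq : OComp o q) {r : ι → α → β} (hr : OComp o r) :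
    OComp o fun i a => q i (r i a) := by
  refine SemiDec.subst (q := fun i (z : α × γ) => r i z.1)
    (A := fun i (z : α × γ) b => q i b = z.2) ?_ ?_
  · exact SemiDec.comp hr (f := fun z : (α × γ) × β => (z.1.1, z.2)) (by fun_prop)
  · exact SemiDec.comp hq (f := fun z : (α × γ) × β => (z.2, z.1.2)) (by fun_prop)

theorem comp_primrec {q : ι → β → γ} (hq : OComp o q) {r : α → β} (hr : Primrec r) :
    OComp o fun i a => q i (r a) :=
  hq.comp (of_primrec hr)

theorem oracle : OComp o o := by
  have h : OComp o fun i k => (pre (o i) (k + 1)).getD k 0 :=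
    SemiDec.of_pre (T := fun w (z : ℕ × ℕ) => w.getD z.1 0 = z.2) (g := fun z => z.1 + 1)
      (PrimrecPred.eq_fun (by fun_prop) (by fun_prop)) (by fun_prop)
  refine SemiDec.of_eq h fun i z => ?_
  simp only [getD_pre (o i) (Nat.lt_succ_self z.1)]

theorem ite {p : ι → α → Prop} [∀ i a, Decidable (p i a)] (hp : SemiDec o p)
    (hn : SemiDec o fun i a => ¬ p i a) {f g : ι → α → β} (hf : OComp o f) (hg : OComp o g) :
    OComp o fun i a => if p i a then f i a else g i a := by
  refine SemiDec.of_eq (((hp.comp Primrec.fst).and hf).or ((hn.comp Primrec.fst).and hg))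
    fun i z => ?_
  by_cases h : p i z.1 <;> simp [h]

/-- A value of the iteration is certified by the finite list of all earlier values. -/
theorem iterate {init : ι → β} (h0 : OComp o fun i (_ : Unit) => init i)
    {q : ι → ℕ × β → β} (hq : OComp o q) {σ : ι → ℕ → β} (hσ0 : ∀ i, σ i 0 = init i)
    (hσ : ∀ i n, σ i (n + 1) = q i (n, σ i n)) : OComp o σ := by
  have key : SemiDec o fun i (z : ℕ × β) => ∃ l : List β,
      ((∃ c, init i = c ∧ l[0]? = some c) ∧
        ∀ j < z.1, ∃ c, l[j]? = some c ∧ ∃ d, q i (j, c) = d ∧ l[j + 1]? = some d) ∧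
      l[z.1]? = some z.2 := by
    refine SemiDec.ex (A := fun i (z : ℕ × β) (l : List β) =>
      ((∃ c, init i = c ∧ l[0]? = some c) ∧
        ∀ j < z.1, ∃ c, l[j]? = some c ∧ ∃ d, q i (j, c) = d ∧ l[j + 1]? = some d) ∧
      l[z.1]? = some z.2) (((SemiDec.ex (A := fun i (z : (ℕ × β) × List β) c =>
        init i = c ∧ z.2[0]? = some c) ?_).and ?_).and ?_)
    · refine SemiDec.and ?_ ?_
      · exact SemiDec.comp h0 (f := fun z : ((ℕ × β) × List β) × β => ((), z.2)) (by fun_prop)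
      · exact SemiDec.of_primrecPred (PrimrecPred.eq_fun (by fun_prop) (by fun_prop))
    · refine SemiDec.forall_lt (A := fun i (z : (ℕ × β) × List β) j =>
        ∃ c, z.2[j]? = some c ∧ ∃ d, q i (j, c) = d ∧ z.2[j + 1]? = some d) (by fun_prop) ?_
      refine SemiDec.ex (A := fun i (z : ((ℕ × β) × List β) × ℕ) c =>
        z.1.2[z.2]? = some c ∧ ∃ d, q i (z.2, c) = d ∧ z.1.2[z.2 + 1]? = some d) ?_
      refine SemiDec.and (SemiDec.of_primrecPred (PrimrecPred.eq_fun (by fun_prop) (by fun_prop)))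
        ?_
      refine SemiDec.ex (A := fun i (z : (((ℕ × β) × List β) × ℕ) × β) d =>
        q i (z.1.2, z.2) = d ∧ z.1.1.2[z.1.2 + 1]? = some d) (SemiDec.and ?_ ?_)
      · exact SemiDec.comp hq (f := fun z : ((((ℕ × β) × List β) × ℕ) × β) × β =>
          ((z.1.1.2, z.1.2), z.2)) (by fun_prop)
      · exact SemiDec.of_primrecPred (PrimrecPred.eq_fun (by fun_prop) (by fun_prop))
    · exact SemiDec.of_primrecPred (PrimrecPred.eq_fun (by fun_prop) (by fun_prop))
  refine key.of_eq fun i z => ?_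
  constructor
  · rintro ⟨l, ⟨⟨c, hc, hl⟩, hstep⟩, hz⟩
    have : ∀ j ≤ z.1, l[j]? = some (σ i j) := by
      intro j
      induction j with
      | zero => intro _; rw [hσ0, hc, hl]
      | succ j ih =>
        intro hj
        obtain ⟨c, h1, d, h2, h3⟩ := hstep j (by omega)
        rw [ih (by omega), Option.some.injEq] at h1
        rw [h3, hσ, h1, h2]
    rw [this _ le_rfl, Option.some.injEq] at hz
    exact hz
  · intro hz
    refine ⟨(List.range (z.1 + 1)).map (σ i), ⟨⟨init i, rfl, ?_⟩, fun j hj => ?_⟩, ?_⟩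
    · simp [hσ0]
    · refine ⟨σ i j, ?_, σ i (j + 1), (hσ i j).symm, ?_⟩ <;> simp [hj, hj.le]
    · simp [hz]

/-- A uniformly computable family of sequences is computed by a machine. -/
theorem exists_transforms {q : ι → ℕ → ℕ} (hq : OComp o q) :
    ∃ Φ : List ℕ → ℕ → Option ℕ, Computable₂ Φ ∧ ∀ i, Transforms Φ (o i) (q i) := by
  classical
  obtain ⟨T, hT, hA, hm⟩ := SemiDec.exists_mono hq
  -- Least accepted value below the length of the prefix. If there is none, `findIdx` returns the
  -- length, which is read as "no output yet". Any accepted value is the right one because the graph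
  -- is functional.
  let f : List ℕ × ℕ → ℕ := fun z =>
    (List.range z.1.length).findIdx fun m => decide (T z.1 (z.2, m))
  have hf : Primrec f := by
    refine Primrec.list_findIdx (f := fun z : List ℕ × ℕ => List.range z.1.length)
      (p := fun z m => decide (T z.1 (z.2, m))) (by fun_prop) ?_
    exact (hT.comp (f := fun z : (List ℕ × ℕ) × ℕ => (z.1.1, (z.1.2, z.2)))
      (by fun_prop)).decide
  refine ⟨fun w n => if f (w, n) < w.length then some (f (w, n)) else none, ?_, ?_⟩
  · exact (Primrec.ite (PrimrecPred.lt_fun (by fun_prop) (by fun_prop)) (by fun_prop)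
      (by fun_prop) : Primrec fun z : List ℕ × ℕ =>
        if f (z.1, z.2) < z.1.length then some (f (z.1, z.2)) else none).to_comp
  · intro i n m
    have hfk : ∀ k, f (pre (o i) k, n) =
        (List.range k).findIdx fun m => decide (T (pre (o i) k) (n, m)) := fun k => by
      simp only [f, RepSpace.length_pre]
    have hsound : ∀ k, f (pre (o i) k, n) < k → T (pre (o i) k) (n, f (pre (o i) k, n)) := by
      intro k hk
      rw [hfk] at hk ⊢
      have := List.findIdx_getElem (xs := List.range k)
        (p := fun m => decide (T (pre (o i) k) (n, m))) (w := by rwa [List.length_range])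
      simpa using this
    constructor
    · intro hnm
      obtain ⟨k, hk⟩ := (hA i (n, m)).1 hnm
      have hk' := hm _ _ _ _ (le_max_left k (m + 1)) hk
      refine ⟨max k (m + 1), ?_⟩
      have hlt : f (pre (o i) (max k (m + 1)), n) < max k (m + 1) := by
        rw [hfk]
        have := List.findIdx_lt_length_of_exists
          (xs := List.range (max k (m + 1)))
          (p := fun m' => decide (T (pre (o i) (max k (m + 1))) (n, m')))
          ⟨m, by simp, by simpa using hk'⟩
        simpa using this
      have h2 := (hA i (n, _)).2 ⟨_, hsound _ hlt⟩
      simp only at h2 hnm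
      dsimp only
      rw [RepSpace.length_pre, if_pos hlt, ← h2, hnm]
    · rintro ⟨k, hk⟩
      dsimp only at hk
      rw [RepSpace.length_pre] at hk
      split_ifs at hk with hlt
      have h2 := (hA i (n, _)).2 ⟨_, hsound k hlt⟩
      simp only [Option.some.injEq] at hk h2
      rw [h2, hk]

end OComp

/-- Semidecidable sets of words are enumerated by computable sequences. -/
theorem SemiDec.exists_enumeration {A : ι → β → List ℕ → Prop}
    (h : SemiDec o fun i (z : β × List ℕ) => A i z.1 z.2) :
    ∃ q : ι → β → ℕ → ℕ, OComp o (fun i (z : β × ℕ) => q i z.1 z.2) ∧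
      ∀ i b v, RepSpace.Enumerates (q i b) v ↔ A i b v := by
  classical
  obtain ⟨T, hT, hA⟩ := h
  -- An index codes a prefix length and a word; the word is enumerated if the test accepts it on
  -- that prefix.
  let v : ℕ → List ℕ := fun c => (Encodable.decode c.unpair.2).getD []
  have hv : Primrec v := by fun_prop
  refine ⟨fun i b c => if T (pre (o i) c.unpair.1) (b, v c) then Encodable.encode (v c) + 1 else 0,
    OComp.ite (p := fun i (z : β × ℕ) => T (pre (o i) z.2.unpair.1) (z.1, v z.2)) ?_ ?_
      (OComp.of_primrec (by fun_prop)) (OComp.of_primrec (by fun_prop)), fun i b w => ?_⟩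
  · exact of_pre (T := fun w (z : β × ℕ) => T w (z.1, v z.2)) (hT.comp
      (f := fun z : List ℕ × (β × ℕ) => (z.1, (z.2.1, v z.2.2))) (by fun_prop)) (by fun_prop)
  · exact of_pre (T := fun w (z : β × ℕ) => ¬ T w (z.1, v z.2)) (hT.comp
      (f := fun z : List ℕ × (β × ℕ) => (z.1, (z.2.1, v z.2.2))) (by fun_prop)).not (by fun_prop)
  · have hAi := hA i (b, w)
    simp only at hAi
    rw [hAi]
    constructor
    · rintro ⟨c, hc⟩
      dsimp only at hc
      split_ifs at hc with hT'
      have : v c = w := Encodable.encode_injective (by omega)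
      exact ⟨_, this ▸ hT'⟩
    · rintro ⟨k, hk⟩
      refine ⟨Nat.pair k (Encodable.encode w), ?_⟩
      have : v (Nat.pair k (Encodable.encode w)) = w := by simp [v]
      dsimp only
      rw [this, Nat.unpair_pair, if_pos hk]

/-- The graph of the output of a machine run on a primitive recursive family of oracles. -/
theorem SemiDec.machine_output {Φ : List ℕ → ℕ → Option ℕ} (hΦ : Computable₂ Φ)
    {p : β → ℕ → ℕ} (hp : Primrec fun z : β × ℕ => p z.1 z.2) :
    SemiDec o fun _ (z : β × ℕ × ℕ) => ∃ k, Φ (pre (p z.1) k) z.2.1 = some z.2.2 := by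
  classical
  refine SemiDec.ex (A := fun _ (z : β × ℕ × ℕ) k => Φ (pre (p z.1) k) z.2.1 = some z.2.2)
    (SemiDec.of_re (ComputablePred.to_re ⟨inferInstance, ?_⟩))
  refine (Primrec.eq (α := Option ℕ)).decide.to_comp.comp (Computable₂.comp hΦ
    (g := fun z : (β × ℕ × ℕ) × ℕ => pre (p z.1.1) z.2) (h := fun z => z.1.2.1) ?_ ?_) ?_
  · exact (Primrec.fun_pre (p := fun z : (β × ℕ × ℕ) × ℕ => p z.1.1) (by fun_prop)
      (hp.comp (f := fun z : β × ℕ => p z.1 z.2)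
        (g := fun z : ((β × ℕ × ℕ) × ℕ) × ℕ => (z.1.1.1, z.2)) (by fun_prop))).to_comp
  · exact Primrec.to_comp (by fun_prop)
  · exact Primrec.to_comp (by fun_prop)

end SemiDec

/-! ### Arithmetic on codes of rational numbers -/

namespace RatCode

/-- Addition of codes of rational numbers. -/
def add (m n : ℕ) : ℕ :=
  Nat.pair (Nat.pair
    (m.unpair.1.unpair.1 * (n.unpair.2 + 1) + n.unpair.1.unpair.1 * (m.unpair.2 + 1))
    (m.unpair.1.unpair.2 * (n.unpair.2 + 1) + n.unpair.1.unpair.2 * (m.unpair.2 + 1)))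
    ((m.unpair.2 + 1) * (n.unpair.2 + 1) - 1)

/-- Negation of codes of rational numbers. -/
def neg (m : ℕ) : ℕ := Nat.pair (Nat.pair m.unpair.1.unpair.2 m.unpair.1.unpair.1) m.unpair.2

/-- A code of `2⁻ᵏ`. -/
def halfPow (k : ℕ) : ℕ := Nat.pair (Nat.pair 1 0) (2 ^ k - 1)

theorem ratNum_add (m n : ℕ) : ratNum (add m n) = ratNum m + ratNum n := by
  have h : (((m.unpair.2 + 1) * (n.unpair.2 + 1) - 1 : ℕ) : ℝ) + 1 =
      ((m.unpair.2 : ℝ) + 1) * ((n.unpair.2 : ℝ) + 1) := by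
    have : (m.unpair.2 + 1) * (n.unpair.2 + 1) - 1 + 1 = (m.unpair.2 + 1) * (n.unpair.2 + 1) :=
      Nat.sub_add_cancel (Nat.succ_le_of_lt (by positivity))
    exact_mod_cast this
  simp only [ratNum, add, Nat.unpair_pair]
  rw [h]
  have h1 : ((m.unpair.2 : ℝ) + 1) ≠ 0 := by positivity
  have h2 : ((n.unpair.2 : ℝ) + 1) ≠ 0 := by positivity
  push_cast
  field_simp
  ring

theorem ratNum_neg (m : ℕ) : ratNum (neg m) = - ratNum m := by
  simp only [ratNum, neg, Nat.unpair_pair]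
  ring

theorem ratNum_halfPow (k : ℕ) : ratNum (halfPow k) = (1 / 2 : ℝ) ^ k := by
  have h : ((2 ^ k - 1 : ℕ) : ℝ) + 1 = 2 ^ k := by
    have : 2 ^ k - 1 + 1 = 2 ^ k := Nat.sub_add_cancel Nat.one_le_two_pow
    exact_mod_cast this
  simp only [ratNum, halfPow, Nat.unpair_pair]
  rw [h]
  simp

theorem ratNum_lt_iff (m n : ℕ) : ratNum m < ratNum n ↔
    m.unpair.1.unpair.1 * (n.unpair.2 + 1) + n.unpair.1.unpair.2 * (m.unpair.2 + 1) <
    n.unpair.1.unpair.1 * (m.unpair.2 + 1) + m.unpair.1.unpair.2 * (n.unpair.2 + 1) := by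
  have h1 : (0 : ℝ) < (m.unpair.2 : ℝ) + 1 := by positivity
  have h2 : (0 : ℝ) < (n.unpair.2 : ℝ) + 1 := by positivity
  rw [ratNum, ratNum, div_lt_div_iff₀ h1 h2, ← Nat.cast_lt (α := ℝ)]
  push_cast
  constructor <;> intro h <;> linarith

@[fun_prop]
theorem primrec_add {α : Type*} [Primcodable α] {f g : α → ℕ} (hf : Primrec f) (hg : Primrec g) :
    Primrec fun a => add (f a) (g a) := by
  unfold add
  fun_prop

@[fun_prop]
theorem primrec_neg : Primrec neg := by
  unfold neg
  fun_prop

@[fun_prop]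
theorem primrec_halfPow : Primrec halfPow := by
  unfold halfPow
  fun_prop

theorem primrecPred_lt {α : Type*} [Primcodable α] {f g : α → ℕ} (hf : Primrec f)
    (hg : Primrec g) : PrimrecPred fun a => ratNum (f a) < ratNum (g a) :=
  (PrimrecPred.lt_fun
    (f := fun a => (f a).unpair.1.unpair.1 * ((g a).unpair.2 + 1) +
      (g a).unpair.1.unpair.2 * ((f a).unpair.2 + 1))
    (g := fun a => (g a).unpair.1.unpair.1 * ((f a).unpair.2 + 1) +
      (f a).unpair.1.unpair.2 * ((g a).unpair.2 + 1)) (by fun_prop) (by fun_prop)).of_eq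
    fun a => (ratNum_lt_iff (f a) (g a)).symm

theorem exists_between {x y : ℝ} (h : x < y) : ∃ r, x < ratNum r ∧ ratNum r < y := by
  obtain ⟨q, h1, h2⟩ := exists_rat_btwn h
  obtain ⟨r, hr⟩ := range_ratNum q
  exact ⟨r, hr ▸ h1, hr ▸ h2⟩

end RatCode

/-! ### Real numbers computable relative to oracles -/

/-- The family `ρ` of real numbers is uniformly computable relative to the family `o` of
oracles: its left and its right cut are semidecidable. -/
def OReal {ι α : Type*} [Primcodable α] (o : ι → ℕ → ℕ) (ρ : ι → α → ℝ) : Prop :=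
  (SemiDec o fun i (z : α × ℕ) => ρ i z.1 < ratNum z.2) ∧
    SemiDec o fun i (z : α × ℕ) => ratNum z.2 < ρ i z.1

theorem exists_halfPow_lt {x : ℝ} (hx : 0 < x) : ∃ n : ℕ, (1 / 2 : ℝ) ^ n < x :=
  exists_pow_lt_of_lt_one hx (by norm_num)

section OReal

variable {ι α β : Type*} [Primcodable α] [Primcodable β] {o : ι → ℕ → ℕ}

theorem SemiDec.lt {ρ τ : ι → α → ℝ} (hρ : OReal o ρ) (hτ : OReal o τ) :
    SemiDec o fun i a => ρ i a < τ i a := by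
  refine (ex (A := fun i a r => ρ i a < ratNum r ∧ ratNum r < τ i a) (hρ.1.and hτ.2)).of_eq
    fun i a => ⟨fun ⟨r, h1, h2⟩ => h1.trans h2, RatCode.exists_between⟩

namespace OReal

theorem comp {ρ : ι → β → ℝ} (h : OReal o ρ) {f : α → β} (hf : Primrec f) :
    OReal o fun i a => ρ i (f a) :=
  ⟨h.1.comp (f := fun z : α × ℕ => (f z.1, z.2)) (by fun_prop),
    h.2.comp (f := fun z : α × ℕ => (f z.1, z.2)) (by fun_prop)⟩

theorem subst {q : ι → α → β} (hq : OComp o q) {ρ : ι → α × β → ℝ} (h : OReal o ρ) :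
    OReal o fun i a => ρ i (a, q i a) := by
  have hq' : OComp o fun i (z : α × ℕ) => q i z.1 := hq.comp_primrec Primrec.fst
  exact ⟨SemiDec.subst hq' (A := fun i z b => ρ i (z.1, b) < ratNum z.2)
      (h.1.comp (f := fun z : (α × ℕ) × β => ((z.1.1, z.2), z.1.2)) (by fun_prop)),
    SemiDec.subst hq' (A := fun i z b => ratNum z.2 < ρ i (z.1, b))
      (h.2.comp (f := fun z : (α × ℕ) × β => ((z.1.1, z.2), z.1.2)) (by fun_prop))⟩

theorem ratNum_primrec {f : α → ℕ} (hf : Primrec f) : OReal o fun _ a => ratNum (f a) :=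
  ⟨SemiDec.of_primrecPred (RatCode.primrecPred_lt (by fun_prop) (by fun_prop)),
    SemiDec.of_primrecPred (RatCode.primrecPred_lt (by fun_prop) (by fun_prop))⟩

theorem ratNum {q : ι → α → ℕ} (hq : OComp o q) : OReal o fun i a => ratNum (q i a) :=
  subst hq (ρ := fun _ z => _root_.ratNum z.2) (ratNum_primrec Primrec.snd)

theorem halfPow {f : α → ℕ} (hf : Primrec f) : OReal o fun _ a => (1 / 2 : ℝ) ^ f a := by
  simp_rw [← RatCode.ratNum_halfPow]
  exact ratNum_primrec (by fun_prop)

theorem zero : OReal o fun _ (_ : α) => (0 : ℝ) := by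
  have : _root_.ratNum 0 = 0 := by simp [_root_.ratNum]
  rw [← this]
  exact ratNum_primrec (Primrec.const 0)

theorem neg {ρ : ι → α → ℝ} (h : OReal o ρ) : OReal o fun i a => - ρ i a := by
  refine ⟨(h.2.comp (f := fun z : α × ℕ => (z.1, RatCode.neg z.2)) (by fun_prop)).of_eq
    fun i z => ?_, (h.1.comp (f := fun z : α × ℕ => (z.1, RatCode.neg z.2)) (by fun_prop)).of_eq
    fun i z => ?_⟩ <;> rw [RatCode.ratNum_neg] <;> constructor <;> intro h' <;> linarith

theorem add {ρ τ : ι → α → ℝ} (hρ : OReal o ρ) (hτ : OReal o τ) :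
    OReal o fun i a => ρ i a + τ i a := by
  constructor
  · refine (SemiDec.ex (A := fun i (z : α × ℕ) r => ρ i z.1 < _root_.ratNum r ∧
      τ i z.1 < _root_.ratNum (RatCode.add z.2 (RatCode.neg r))) (SemiDec.and ?_ ?_)).of_eq ?_
    · exact hρ.1.comp (f := fun z : (α × ℕ) × ℕ => (z.1.1, z.2)) (by fun_prop)
    · exact hτ.1.comp (f := fun z : (α × ℕ) × ℕ => (z.1.1, RatCode.add z.1.2 (RatCode.neg z.2)))
        (by fun_prop)
    · intro i z
      simp only [RatCode.ratNum_add, RatCode.ratNum_neg]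
      constructor
      · rintro ⟨r, h1, h2⟩
        linarith
      · intro h
        obtain ⟨r, h1, h2⟩ := RatCode.exists_between
          (show ρ i z.1 < _root_.ratNum z.2 - τ i z.1 by linarith)
        exact ⟨r, h1, by linarith⟩
  · refine (SemiDec.ex (A := fun i (z : α × ℕ) r => _root_.ratNum r < ρ i z.1 ∧
      _root_.ratNum (RatCode.add z.2 (RatCode.neg r)) < τ i z.1) (SemiDec.and ?_ ?_)).of_eq ?_
    · exact hρ.2.comp (f := fun z : (α × ℕ) × ℕ => (z.1.1, z.2)) (by fun_prop)
    · exact hτ.2.comp (f := fun z : (α × ℕ) × ℕ => (z.1.1, RatCode.add z.1.2 (RatCode.neg z.2)))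
        (by fun_prop)
    · intro i z
      simp only [RatCode.ratNum_add, RatCode.ratNum_neg]
      constructor
      · rintro ⟨r, h1, h2⟩
        linarith
      · intro h
        obtain ⟨r, h1, h2⟩ := RatCode.exists_between
          (show _root_.ratNum z.2 - τ i z.1 < ρ i z.1 by linarith)
        exact ⟨r, h2, by linarith⟩

theorem sub {ρ τ : ι → α → ℝ} (hρ : OReal o ρ) (hτ : OReal o τ) :
    OReal o fun i a => ρ i a - τ i a := by
  simp_rw [sub_eq_add_neg]
  exact hρ.add hτ.neg

/-- A strict inequality for the limit already holds for some approximation with its error bound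
added or subtracted: take `2⁻ⁿ` below half of the gap. -/
theorem of_approx {ρ : ι → α → ℝ} {τ : ι → α × ℕ → ℝ} (hτ : OReal o τ)
    (h : ∀ i a n, |τ i (a, n) - ρ i a| ≤ (1 / 2 : ℝ) ^ n) : OReal o ρ := by
  have hpow : OReal o fun _ (z : (α × ℕ) × ℕ) => (1 / 2 : ℝ) ^ z.2 := halfPow Primrec.snd
  have hr : OReal o fun _ (z : (α × ℕ) × ℕ) => _root_.ratNum z.1.2 :=
    ratNum_primrec (by fun_prop)
  have hτ' : OReal o fun i (z : (α × ℕ) × ℕ) => τ i (z.1.1, z.2) :=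
    hτ.comp (f := fun z : (α × ℕ) × ℕ => (z.1.1, z.2)) (by fun_prop)
  constructor
  · refine (SemiDec.ex (A := fun i (z : α × ℕ) n => τ i (z.1, n) + (1 / 2 : ℝ) ^ n <
      _root_.ratNum z.2) (SemiDec.lt (hτ'.add hpow) hr)).of_eq fun i z => ?_
    constructor
    · rintro ⟨n, hn⟩
      have := (abs_le.1 (h i z.1 n)).1
      linarith
    · intro hlt
      obtain ⟨n, hn⟩ := exists_halfPow_lt
        (show 0 < (_root_.ratNum z.2 - ρ i z.1) / 2 by linarith)
      refine ⟨n, ?_⟩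
      have := (abs_le.1 (h i z.1 n)).2
      linarith
  · refine (SemiDec.ex (A := fun i (z : α × ℕ) n => _root_.ratNum z.2 < τ i (z.1, n) -
      (1 / 2 : ℝ) ^ n) (SemiDec.lt hr (hτ'.sub hpow))).of_eq fun i z => ?_
    constructor
    · rintro ⟨n, hn⟩
      have := (abs_le.1 (h i z.1 n)).2
      linarith
    · intro hlt
      obtain ⟨n, hn⟩ := exists_halfPow_lt
        (show 0 < (ρ i z.1 - _root_.ratNum z.2) / 2 by linarith)
      refine ⟨n, ?_⟩
      have := (abs_le.1 (h i z.1 n)).1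
      linarith

end OReal

end OReal

/-! ### Open and compact sets in the Cauchy representation -/

namespace RepSpace

variable {X : Type*}

theorem isOpenSet_of_enumerates {δ : RepSpace X} {A : Set X} {o : ℕ → ℕ}
    (h : ∀ q x, δ.rel q x → (x ∈ A ↔ ∃ k, Enumerates o (pre q k))) : δ.IsOpenSet A := by
  intro p x hp hx
  obtain ⟨k, hk⟩ := (h p x hp).1 hx
  exact ⟨k, fun q y hq hy => (h q y hy).2 ⟨k, hq ▸ hk⟩⟩

end RepSpace

namespace ComputableMetricStructure

open RepSpace

variable {X : Type*} [MetricSpace X] (S : ComputableMetricStructure X)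

theorem oReal_dist {ι : Type*} (o : ι → ℕ → ℕ) :
    OReal o fun _ (z : ℕ × ℕ) => dist (S.a z.1) (S.a z.2) := by
  obtain ⟨f, hf, h⟩ := S.computable_dist
  refine OReal.of_approx (τ := fun _ z => ratNum (f (z.1.1, z.1.2, z.2)))
    (OReal.ratNum ((OComp.of_computable hf).comp_primrec
      (r := fun z : (ℕ × ℕ) × ℕ => (z.1.1, z.1.2, z.2)) (by fun_prop))) ?_
  exact fun _ z n => h z.1 z.2 n

/-- Every point at distance at most `r` from `y` has a name extending the word `v`, as seen from
the distances of `y` to the points listed in `v`. -/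
def Within (v : List ℕ) (y : X) (r : ℝ) : Prop :=
  ∀ j < v.length, dist (S.a (v.getD j 0)) y + r < (1 / 2 : ℝ) ^ j

/-- Every point that has a name extending `v` is in the ball with code `b`, as seen from the
distances between points of the dense sequence. -/
def WordInBall (v : List ℕ) (b : ℕ × ℕ) : Prop :=
  ∃ j, j < v.length ∧ dist (S.a (v.getD j 0)) (S.a b.1) + (1 / 2 : ℝ) ^ j < ratNum b.2

variable {S}

theorem Within.mono {v : List ℕ} {y z : X} {r s : ℝ} (h : S.Within v y r)
    (hs : dist y z + s ≤ r) : S.Within v z s := fun j hj => by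
  have := h j hj
  have := dist_triangle (S.a (v.getD j 0)) y z
  linarith

/-- Overwriting the start of any name of `z` by `v` leaves a name of `z`, since the margin `r`
absorbs the distance from `y` to `z`. -/
theorem Within.exists_rel {v : List ℕ} {y z : X} {r : ℝ} (h : S.Within v y r)
    (hz : dist z y ≤ r) : ∃ q, S.rep.rel q z ∧ pre q v.length = v := by
  obtain ⟨q, hq⟩ := S.rep.surj z
  refine ⟨fun j => if j < v.length then v.getD j 0 else q j, fun j => ?_,
    pre_eq_iff.2 ⟨rfl, fun j hj => by simp [hj]⟩⟩
  by_cases hj : j < v.length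
  · have h1 := h j hj
    have h2 := dist_triangle (S.a (v.getD j 0)) y z
    rw [dist_comm] at hz
    simp only [hj, if_true]
    linarith
  · simp only [hj, if_false]
    exact hq j

/-- Finitely many strict inequalities have a common slack. -/
theorem Within.exists_pos {v : List ℕ} {y : X} (h : S.Within v y 0) :
    ∃ r > 0, S.Within v y r := by
  have : ∀ n, (∀ j < n, j < v.length → dist (S.a (v.getD j 0)) y < (1 / 2 : ℝ) ^ j) →
      ∃ r > 0, ∀ j < n, j < v.length → dist (S.a (v.getD j 0)) y + r < (1 / 2 : ℝ) ^ j := by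
    intro n
    induction n with
    | zero => exact fun _ => ⟨1, one_pos, by simp⟩
    | succ n ih =>
      intro hn
      obtain ⟨r, hr, h'⟩ := ih fun j hj => hn j (by omega)
      by_cases hv : n < v.length
      · have := hn n (by omega) hv
        refine ⟨min r (((1 / 2 : ℝ) ^ n - dist (S.a (v.getD n 0)) y) / 2),
          lt_min hr (by linarith), fun j hj hjv => ?_⟩
        have h1 := min_le_left r (((1 / 2 : ℝ) ^ n - dist (S.a (v.getD n 0)) y) / 2)
        have h2 := min_le_right r (((1 / 2 : ℝ) ^ n - dist (S.a (v.getD n 0)) y) / 2)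
        rcases Nat.lt_succ_iff_lt_or_eq.1 hj with hj | rfl
        · have := h' j hj hjv
          linarith
        · linarith
      · refine ⟨r, hr, fun j hj hjv => h' j (by omega) hjv⟩
  obtain ⟨r, hr, h'⟩ := this v.length fun j _ hj => by simpa using h j hj
  exact ⟨r, hr, fun j hj => h' j hj hj⟩

-- Names only guarantee non-strict bounds, hence no margin. Dropping the first entry of a name
-- halves all errors and makes the bounds strict.
variable (S) in
theorem exists_strict_name (y : X) : ∃ q, S.rep.rel q y ∧ ∀ k, S.Within (pre q k) y 0 := by
  obtain ⟨q, hq⟩ := S.rep.surj y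
  have h : ∀ n, dist (S.a (q (n + 1))) y < (1 / 2 : ℝ) ^ n := fun n => by
    have h1 : dist (S.a (q (n + 1))) y ≤ (1 / 2 : ℝ) ^ (n + 1) := hq (n + 1)
    have h2 : (0 : ℝ) < (1 / 2 : ℝ) ^ n := by positivity
    rw [pow_succ] at h1
    linarith
  refine ⟨fun n => q (n + 1), fun n => (h n).le, fun k j hj => ?_⟩
  rw [length_pre] at hj
  rw [getD_pre _ hj, add_zero]
  exact h j

/-- An enumerated word belonging to a name of an open set describes a subset of that set. -/
theorem Within.mem_of_enumerates {v : List ℕ} {y z : X} {r : ℝ} (h : S.Within v y r)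
    (hz : dist z y ≤ r) {p : ℕ → ℕ} {U : S.rep.Opens} (hp : S.rep.opens.rel p U)
    (hv : Enumerates p v) : z ∈ U.1 := by
  obtain ⟨q, hq, hqv⟩ := h.exists_rel hz
  exact (hp q z hq).2 ⟨v.length, hqv.symm ▸ hv⟩

theorem exists_within_of_mem {y : X} {p : ℕ → ℕ} {U : S.rep.Opens} (hp : S.rep.opens.rel p U)
    (hy : y ∈ U.1) : ∃ v, Enumerates p v ∧ ∃ r > 0, S.Within v y r := by
  obtain ⟨q, hq, hs⟩ := S.exists_strict_name y
  obtain ⟨k, hk⟩ := (hp q y hq).1 hy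
  exact ⟨_, hk, (hs k).exists_pos⟩

/-- With the next lemma: the final topology of the Cauchy representation is the metric topology.
Here the slack of an enumerated prefix of a strict name is the radius of a ball inside `U`. -/
theorem isOpen_of_isOpenSet {U : Set X} (hU : S.rep.IsOpenSet U) : IsOpen U := by
  obtain ⟨p, hp⟩ := S.rep.opens.surj ⟨U, hU⟩
  refine Metric.isOpen_iff.2 fun y hy => ?_
  obtain ⟨v, hv, r, hr, h⟩ := exists_within_of_mem hp hy
  exact ⟨r, hr, fun z hz => h.mem_of_enumerates (Metric.mem_ball.1 hz).le hp hv⟩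

theorem isOpenSet_of_isOpen {U : Set X} (hU : IsOpen U) : S.rep.IsOpenSet U := by
  intro p x hp hx
  obtain ⟨ε, hε, h⟩ := Metric.isOpen_iff.1 hU x hx
  obtain ⟨n, hn⟩ := exists_halfPow_lt (half_pos hε)
  refine ⟨n + 1, fun q y hpq hy => h ?_⟩
  have h1 : dist (S.a (p n)) x ≤ (1 / 2 : ℝ) ^ n := hp n
  have h2 : dist (S.a (q n)) y ≤ (1 / 2 : ℝ) ^ n := hy n
  rw [apply_eq_of_pre_eq hpq (Nat.lt_succ_self n), dist_comm] at h2
  have h3 := dist_triangle y (S.a (p n)) x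
  rw [Metric.mem_ball]
  linarith

theorem isSaturated (K : Set X) : S.rep.IsSaturated K := by
  intro x hx
  by_contra hxK
  exact hx ⟨{x}ᶜ, isOpenSet_of_isOpen isOpen_compl_singleton⟩
    (fun y hy hyx => hxK (Set.mem_singleton_iff.1 hyx ▸ hy)) rfl

/-- The ball with centre and radius coded by `b`. -/
def ball (S : ComputableMetricStructure X) (b : ℕ × ℕ) : Set X :=
  Metric.ball (S.a b.1) (ratNum b.2)

/-- The union of the balls with codes in `P`, as an element of `𝒪(X)`. -/
def ballUnion (S : ComputableMetricStructure X) (P : Set (ℕ × ℕ)) : S.rep.Opens :=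
  ⟨⋃ b ∈ P, S.ball b, isOpenSet_of_isOpen (isOpen_biUnion fun _ _ => Metric.isOpen_ball)⟩

theorem mem_ballUnion {P : Set (ℕ × ℕ)} {y : X} :
    y ∈ (S.ballUnion P).1 ↔ ∃ b ∈ P, dist y (S.a b.1) < ratNum b.2 := by
  simp [ballUnion, ball]

/-- Formal inclusion of words in balls is enough: at a point of the ball, an entry of precision less
than half the remaining distance to the boundary witnesses it. -/
theorem rel_ballUnion {P : Set (ℕ × ℕ)} {p : ℕ → ℕ}
    (hp : ∀ v, Enumerates p v ↔ ∃ b ∈ P, S.WordInBall v b) :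
    S.rep.opens.rel p (S.ballUnion P) := by
  intro q x hq
  rw [mem_ballUnion]
  constructor
  · rintro ⟨b, hb, hx⟩
    obtain ⟨n, hn⟩ := exists_halfPow_lt (show 0 < (ratNum b.2 - dist x (S.a b.1)) / 2 by linarith)
    refine ⟨n + 1, (hp _).2 ⟨b, hb, n, by rw [length_pre]; omega, ?_⟩⟩
    rw [getD_pre q (Nat.lt_succ_self n)]
    have h1 : dist (S.a (q n)) x ≤ (1 / 2 : ℝ) ^ n := hq n
    have h2 := dist_triangle (S.a (q n)) x (S.a b.1)
    linarith
  · rintro ⟨k, hk⟩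
    obtain ⟨b, hb, j, hj, h⟩ := (hp _).1 hk
    rw [length_pre] at hj
    rw [getD_pre q hj] at h
    have h1 : dist (S.a (q j)) x ≤ (1 / 2 : ℝ) ^ j := hq j
    have h2 := dist_triangle_left x (S.a b.1) (S.a (q j))
    exact ⟨b, hb, by linarith⟩

/-- Take a name of the ball union in which every entry concerns only one ball. By compactness a
finite prefix of it already forces the inclusion of `K`. The finitely many balls of `P` mentioned in
this prefix have a union with a name starting with the same prefix, so they cover `K`. -/
theorem exists_finite_subcover {K : Set X} (hK : S.rep.IsCompactSet K) {P : Set (ℕ × ℕ)}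
    (h : K ⊆ (S.ballUnion P).1) :
    ∃ L : List (ℕ × ℕ), (∀ b ∈ L, b ∈ P) ∧ K ⊆ (S.ballUnion {b | b ∈ L}).1 := by
  classical
  let name : Set (ℕ × ℕ) → ℕ → ℕ := fun Q c =>
    match (Encodable.decode c : Option ((ℕ × ℕ) × List ℕ)) with
    | some z => if z.1 ∈ Q ∧ S.WordInBall z.2 z.1 then Encodable.encode z.2 + 1 else 0
    | none => 0
  have hname : ∀ Q, S.rep.opens.rel (name Q) (S.ballUnion Q) := fun Q => by
    refine rel_ballUnion fun v => ⟨?_, ?_⟩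
    · rintro ⟨c, hc⟩
      simp only [name] at hc
      split at hc
      · rename_i z hz
        split_ifs at hc with h'
        have : z.2 = v := Encodable.encode_injective (by omega)
        exact ⟨z.1, h'.1, this ▸ h'.2⟩
      · omega
    · rintro ⟨b, hb, hv⟩
      refine ⟨Encodable.encode (b, v), ?_⟩
      simp only [name, Encodable.encodek]
      exact if_pos ⟨hb, hv⟩
  obtain ⟨k, hk⟩ := hK (name P) (S.ballUnion P) (hname P) h
  let L : List (ℕ × ℕ) := ((List.range k).filterMap fun c =>
    ((Encodable.decode c : Option ((ℕ × ℕ) × List ℕ)).map Prod.fst)).filter fun b => b ∈ P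
  have hL : ∀ b, b ∈ L ↔ (∃ c < k, ∃ v, (Encodable.decode c :
      Option ((ℕ × ℕ) × List ℕ)) = some (b, v)) ∧ b ∈ P := fun b => by
    simp [L]
  refine ⟨L, fun b hb => ((hL b).1 hb).2, hk (name {b | b ∈ L}) _ (pre_congr fun c hc => ?_)
    (hname _)⟩
  simp only [name]
  split
  · rename_i z hz
    have : z.1 ∈ L ↔ z.1 ∈ P := by
      rw [hL]
      exact ⟨fun h => h.2, fun h => ⟨⟨c, hc, z.2, hz⟩, h⟩⟩
    simp [this]
  · rfl

/-- Used to verify covering conditions: it suffices that all small enough rational balls near `y`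
satisfy the condition defining `P`. -/
theorem mem_ballUnion_of_small {P : Set (ℕ × ℕ)} {y : X} {r : ℝ} (hr : 0 < r)
    (h : ∀ b : ℕ × ℕ, 0 < ratNum b.2 → dist y (S.a b.1) + ratNum b.2 < r → b ∈ P) :
    y ∈ (S.ballUnion P).1 := by
  rw [mem_ballUnion]
  obtain ⟨i, hi⟩ := S.dense.exists_dist_lt y (ε := r / 3) (by linarith)
  obtain ⟨s, h1, h2⟩ := RatCode.exists_between (show r / 3 < r / 2 by linarith)
  exact ⟨(i, s), h (i, s) (by dsimp only; linarith) (by dsimp only; linarith), hi.trans h1⟩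

theorem semiDec_within {ι α : Type*} [Primcodable α] {o : ι → ℕ → ℕ} {v : α → List ℕ}
    (hv : Primrec v) {y : ι → α → X} (hy : OReal o fun i (z : α × ℕ) => dist (y i z.1) (S.a z.2))
    {r : ι → α → ℝ} (hr : OReal o r) : SemiDec o fun i z => S.Within (v z) (y i z) (r i z) := by
  refine SemiDec.forall_lt (f := fun z => (v z).length)
    (A := fun i z j => dist (S.a ((v z).getD j 0)) (y i z) + r i z < (1 / 2 : ℝ) ^ j)
    (by fun_prop) (SemiDec.lt (OReal.add ?_ (hr.comp Primrec.fst)) (OReal.halfPow Primrec.snd))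
  simp_rw [dist_comm (S.a _)]
  exact hy.comp (f := fun z : α × ℕ => (z.1, (v z.1).getD z.2 0)) (by fun_prop)

theorem semiDec_wordInBall {ι α : Type*} [Primcodable α] {o : ι → ℕ → ℕ} {v : α → List ℕ}
    (hv : Primrec v) {c : α → ℕ} (hc : Primrec c) {r : ι → α → ℝ} (hr : OReal o r) :
    SemiDec o fun i z => ∃ j, j < (v z).length ∧
      dist (S.a ((v z).getD j 0)) (S.a (c z)) + (1 / 2 : ℝ) ^ j < r i z := by
  refine SemiDec.ex (A := fun i z j => j < (v z).length ∧
      dist (S.a ((v z).getD j 0)) (S.a (c z)) + (1 / 2 : ℝ) ^ j < r i z) (SemiDec.and ?_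
    (SemiDec.lt (OReal.add ?_ (OReal.halfPow Primrec.snd)) (hr.comp Primrec.fst)))
  · exact SemiDec.of_primrecPred (PrimrecPred.lt_fun (by fun_prop) (by fun_prop))
  · exact (S.oReal_dist o).comp (f := fun z : α × ℕ => ((v z.1).getD z.2 0, c z.1)) (by fun_prop)

end ComputableMetricStructure

/-! ### Names of pairs and computable sequences -/

/-- The sequence with even entries `p` and odd entries `q`. -/
def interleave (p q : ℕ → ℕ) (n : ℕ) : ℕ := if n % 2 = 0 then p (n / 2) else q (n / 2)

theorem interleave_even (p q : ℕ → ℕ) : (fun n => interleave p q (2 * n)) = p := by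
  funext n
  rw [interleave, if_pos (by omega), show 2 * n / 2 = n by omega]

theorem interleave_odd (p q : ℕ → ℕ) : (fun n => interleave p q (2 * n + 1)) = q := by
  funext n
  rw [interleave, if_neg (by omega), show (2 * n + 1) / 2 = n by omega]

theorem RepSpace.computableMap_nat {Y : Type*} {δ : RepSpace Y} {f : ℕ → Y}
    {q : (ℕ → ℕ) → ℕ → ℕ → ℕ} (hq : OComp (fun p => p) fun p (z : ℕ × ℕ) => q p z.1 z.2)
    (h : ∀ p n, δ.rel (q p n) (f n)) : ComputableMap nat δ f := by
  have h0 : OComp (fun p : ℕ → ℕ => p) fun p (_ : ℕ) => p 0 :=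
    OComp.oracle.comp_primrec (Primrec.const 0)
  have hq' : OComp (fun p : ℕ → ℕ => p) fun p c => q p (p 0) c := by
    refine SemiDec.subst (q := fun p (z : ℕ × ℕ) => p 0)
      (A := fun p (z : ℕ × ℕ) n => q p n z.1 = z.2) (OComp.comp_primrec h0 Primrec.fst) ?_
    exact SemiDec.comp hq (f := fun z : (ℕ × ℕ) × ℕ => ((z.2, z.1.1), z.1.2)) (by fun_prop)
  obtain ⟨Φ, hΦ, hT⟩ := hq'.exists_transforms
  refine ⟨Φ, hΦ, fun p n hp _ => ⟨q p (p 0), f n, hT p, ?_, rfl⟩⟩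
  obtain rfl : p 0 = n := hp
  exact h p _

/-! ### From small compact balls to an effective relatively compact system -/

namespace ComputableMetricStructure

open RepSpace

variable {X : Type*} [MetricSpace X] {S : ComputableMetricStructure X}

theorem EffectivelyLocallyCompactBalls.exists_machine (h : S.EffectivelyLocallyCompactBalls) :
    ∃ Φ : List ℕ → ℕ → Option ℕ, Computable₂ Φ ∧ ∀ (p : ℕ → ℕ) (x : X) (ε : ℝ),
      S.rep.rel (fun n => p (2 * n)) x → RepSpace.real.rel (fun n => p (2 * n + 1)) ε → 0 < ε →
      ∃ (q : ℕ → ℕ) (ρ : ℝ) (K : S.rep.Compacts), Transforms Φ p q ∧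
        RepSpace.real.rel (fun n => q (2 * n + 1)) ρ ∧
        S.rep.compacts.rel (fun n => q (2 * (2 * n))) K ∧ 0 < ρ ∧
        K.1 = Metric.closedBall x ρ ∧ K.1 ⊆ Metric.ball x ε := by
  obtain ⟨Φ, hΦ, h⟩ := h
  refine ⟨Φ, hΦ, fun p x ε hx hε hpos => ?_⟩
  obtain ⟨q, ⟨K, ρ⟩, hT, ⟨hK, hρ⟩, h1, h2, h3⟩ := h p (x, ε) ⟨hx, hε⟩ hpos
  exact ⟨q, ρ, ⟨K.1, K.2.1⟩, hT, hρ, hK.1, h1, h2, h3⟩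

/-- The name of the pair `(a i, 2⁻ᵏ)` whose first component starts with the word `w`, for
`d = (i, w, k)`. -/
def centreName (d : ℕ × List ℕ × ℕ) : ℕ → ℕ :=
  interleave (fun n => d.2.1.getD n d.1) fun _ => RatCode.halfPow d.2.2

theorem primrec_centreName : Primrec fun z : (ℕ × List ℕ × ℕ) × ℕ => centreName z.1 z.2 := by
  unfold centreName interleave
  exact Primrec.ite (PrimrecPred.eq_fun (by fun_prop) (by fun_prop)) (by fun_prop) (by fun_prop)

theorem rel_getD {w : List ℕ} {i : ℕ} (h : S.Within w (S.a i) 0) :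
    S.rep.rel (fun n => w.getD n i) (S.a i) := by
  intro n
  by_cases hn : n < w.length
  · have := h n hn
    rw [add_zero] at this
    simp only [List.getD_eq_getElem?_getD, List.getElem?_eq_getElem hn, Option.getD_some]
      at this ⊢
    exact this.le
  · simp only [List.getD_eq_getElem?_getD, List.getElem?_eq_none (not_lt.1 hn),
      Option.getD_none, dist_self]
    positivity

theorem rel_real_halfPow (k : ℕ) :
    RepSpace.real.rel (fun _ => RatCode.halfPow k) ((1 / 2 : ℝ) ^ k) := by
  intro n
  rw [RatCode.ratNum_halfPow, dist_self]
  positivity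

theorem EffectivelyLocallyCompactBalls.admitsErcs (h : S.EffectivelyLocallyCompactBalls) :
    S.rep.AdmitsErcs := by
  classical
  obtain ⟨Φ, hΦ, hM⟩ := h.exists_machine
  have hW : SemiDec (fun (_ : Unit) (_ : ℕ) => 0)
      fun _ (d : ℕ × List ℕ × ℕ) => S.Within d.2.1 (S.a d.1) 0 := by
    refine semiDec_within (v := fun d : ℕ × List ℕ × ℕ => d.2.1) (y := fun _ d => S.a d.1)
      (r := fun _ _ => 0) (by fun_prop) ?_ OReal.zero
    exact (S.oReal_dist _).comp (f := fun z : (ℕ × List ℕ × ℕ) × ℕ => (z.1.1, z.2)) (by fun_prop)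
  obtain ⟨T, hT, hTW⟩ := hW
  -- Besides `(i, w, k)` the index `n` carries a stage at which the condition that `w` starts a name
  -- of `a i` has been confirmed. This makes validity of an index decidable; invalid indices receive
  -- empty sets.
  let data : ℕ → ℕ × List ℕ × ℕ := fun n => (Encodable.decode n.unpair.2).getD (0, [], 0)
  have hdata : Primrec data := by fun_prop
  let Valid : ℕ → Prop := fun n => T (pre (fun _ => 0) n.unpair.1) (data n)
  have hValid : PrimrecPred Valid := hT.comp
    (f := fun n : ℕ => (pre (fun _ => 0) n.unpair.1, data n))
    ((Primrec.fun_pre (by fun_prop) (by fun_prop)).pair hdata)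
  have hValidW : ∀ n, Valid n → S.Within (data n).2.1 (S.a (data n).1) 0 := fun n hn =>
    (hTW () _).2 ⟨_, hn⟩
  have hout : ∀ n, ∃ (q : ℕ → ℕ) (ρ : ℝ) (K : S.rep.Compacts),
      (Valid n → Transforms Φ (centreName (data n)) q ∧
        RepSpace.real.rel (fun n => q (2 * n + 1)) ρ ∧
        S.rep.compacts.rel (fun n => q (2 * (2 * n))) K ∧ 0 < ρ ∧
        K.1 = Metric.closedBall (S.a (data n).1) ρ ∧
        K.1 ⊆ Metric.ball (S.a (data n).1) ((1 / 2 : ℝ) ^ (data n).2.2)) ∧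
      (¬ Valid n → K.1 = ∅) := fun n => by
    by_cases hn : Valid n
    · obtain ⟨q, ρ, K, hK⟩ := hM (centreName (data n)) (S.a (data n).1)
        ((1 / 2 : ℝ) ^ (data n).2.2)
        (by unfold centreName; rw [interleave_even]; exact rel_getD (hValidW n hn))
        (by unfold centreName; rw [interleave_odd]; exact rel_real_halfPow _) (by positivity)
      exact ⟨q, ρ, K, fun _ => hK, fun h => (h hn).elim⟩
    · exact ⟨fun _ => 0, 0, ⟨∅, isSaturated _, fun p U _ _ => ⟨0, fun q V _ _ => by simp⟩⟩,
        fun h => (hn h).elim, fun _ => rfl⟩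
  choose q ρ K hK hKempty using hout
  let G : ℕ → ℕ → ℕ → Prop := fun n c m =>
    Valid n ∧ ∃ k, Φ (pre (centreName (data n)) k) c = some m
  have hG : ∀ n c m, G n c m ↔ Valid n ∧ q n c = m := fun n c m =>
    and_congr_right fun hn => ((hK n hn).1 c m).symm
  have hGs : SemiDec (fun p : ℕ → ℕ => p) fun _ (z : ℕ × ℕ × ℕ) => G z.1 z.2.1 z.2.2 := by
    refine (SemiDec.of_primrecPred (hValid.comp Primrec.fst)).and ?_
    exact (SemiDec.machine_output hΦ primrec_centreName).comp
      (f := fun z : ℕ × ℕ × ℕ => (data z.1, z.2.1, z.2.2)) (by fun_prop)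
  -- The `t`-th approximation of the radius minus its error `2⁻ᵗ` never exceeds the radius and
  -- converges to it, so the union of these balls is the open ball.
  let P : ℕ → Set (ℕ × ℕ) := fun n => {b | ∃ t m, G n (2 * t + 1) m ∧
    b = ((data n).1, RatCode.add m (RatCode.neg (RatCode.halfPow t)))}
  obtain ⟨qU, hqU, hqUe⟩ := SemiDec.exists_enumeration (o := fun p : ℕ → ℕ => p)
    (A := fun _ n v => ∃ b, b ∈ P n ∧ S.WordInBall v b) <| by
      refine SemiDec.ex (A := fun _ (z : ℕ × List ℕ) b => b ∈ P z.1 ∧ S.WordInBall z.2 b)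
        (SemiDec.and ?_ ?_)
      · refine SemiDec.ex (A := fun _ (z : (ℕ × List ℕ) × (ℕ × ℕ)) t => ∃ m,
          G z.1.1 (2 * t + 1) m ∧
            z.2 = ((data z.1.1).1, RatCode.add m (RatCode.neg (RatCode.halfPow t)))) ?_
        refine SemiDec.ex (A := fun _ (z : ((ℕ × List ℕ) × (ℕ × ℕ)) × ℕ) m =>
          G z.1.1.1 (2 * z.2 + 1) m ∧
            z.1.2 = ((data z.1.1.1).1, RatCode.add m (RatCode.neg (RatCode.halfPow z.2))))
          (SemiDec.and ?_ (SemiDec.of_primrecPred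
            (PrimrecPred.eq_fun (by fun_prop) (by fun_prop))))
        exact hGs.comp (f := fun z : (((ℕ × List ℕ) × (ℕ × ℕ)) × ℕ) × ℕ =>
          (z.1.1.1.1, 2 * z.1.2 + 1, z.2)) (by fun_prop)
      · exact semiDec_wordInBall (v := fun z : (ℕ × List ℕ) × (ℕ × ℕ) => z.1.2)
          (c := fun z => z.2.1) (r := fun _ z => _root_.ratNum z.2.2) (by fun_prop)
          (by fun_prop) (OReal.ratNum_primrec (by fun_prop))
  -- The positions `2 * (2 * c)` hold the `𝒦`-component of the machine's output. For an invalid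
  -- index every word is enumerated, which names the empty set.
  obtain ⟨qK, hqK, hqKe⟩ := SemiDec.exists_enumeration (o := fun p : ℕ → ℕ => p)
    (A := fun _ n z => ¬ Valid n ∨ ∃ c, G n (2 * (2 * c)) (Encodable.encode z + 1)) <| by
      refine (SemiDec.of_primrecPred (hValid.not.comp Primrec.fst)).or ?_
      refine SemiDec.ex (A := fun _ (z : ℕ × List ℕ) c =>
        G z.1 (2 * (2 * c)) (Encodable.encode z.2 + 1)) ?_
      exact hGs.comp (f := fun z : (ℕ × List ℕ) × ℕ =>
        (z.1.1, 2 * (2 * z.2), Encodable.encode z.1.2 + 1)) (by fun_prop)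
  have hmem : ∀ n y, y ∈ (S.ballUnion (P n)).1 ↔ Valid n ∧
      ∃ t, dist y (S.a (data n).1) < ratNum (q n (2 * t + 1)) - (1 / 2 : ℝ) ^ t := by
    intro n y
    rw [mem_ballUnion]
    constructor
    · rintro ⟨_, ⟨t, m, hm, rfl⟩, hy⟩
      obtain ⟨hn, rfl⟩ := (hG _ _ _).1 hm
      simp only [RatCode.ratNum_add, RatCode.ratNum_neg, RatCode.ratNum_halfPow] at hy
      exact ⟨hn, t, by linarith⟩
    · rintro ⟨hn, t, hy⟩
      refine ⟨_, ⟨t, _, (hG _ _ _).2 ⟨hn, rfl⟩, rfl⟩, ?_⟩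
      simp only [RatCode.ratNum_add, RatCode.ratNum_neg, RatCode.ratNum_halfPow]
      linarith
  have hsub : ∀ n, (S.ballUnion (P n)).1 ⊆ (K n).1 := by
    intro n y hy
    obtain ⟨hn, t, hy⟩ := (hmem n y).1 hy
    obtain ⟨-, hρ, -, -, hKb, -⟩ := hK n hn
    have h1 : dist (ratNum (q n (2 * t + 1))) (ρ n) ≤ (1 / 2 : ℝ) ^ t := hρ t
    rw [Real.dist_eq] at h1
    have h2 := (abs_le.1 h1).2
    rw [hKb, Metric.mem_closedBall]
    linarith
  refine ⟨fun n => S.ballUnion (P n), K, {z | z.1 = z.2}, ?_, ?_, ?_, ?_, ?_⟩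
  · exact computableMap_nat hqU fun p n => rel_ballUnion fun v => hqUe p n v
  · refine computableMap_nat hqK fun p n o U ho => ?_
    simp only [hqKe]
    by_cases hn : Valid n
    · rw [(hK n hn).2.2.1 o U ho]
      simp only [hn, not_true_eq_false, false_or, hG, true_and]
      rfl
    · simp [hn, hKempty n hn]
  · refine ComputablePred.to_re ⟨inferInstance, ?_⟩
    exact (PrimrecPred.eq_fun (α := ℕ × ℕ) Primrec.fst Primrec.snd).decide.to_comp
  · rintro m n hmn
    obtain rfl : m = n := hmn
    exact hsub m
  · intro W
    refine Set.Subset.antisymm (fun x hx => ?_) ?_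
    · obtain ⟨ε, hε, hball⟩ := Metric.isOpen_iff.1 (isOpen_of_isOpenSet W.2) x hx
      obtain ⟨k, hk⟩ := exists_halfPow_lt (half_pos hε)
      obtain ⟨qx, hqx, hstrict⟩ := S.exists_strict_name x
      obtain ⟨r, ρ', -, hTr, hρ', -, hpos, -, -⟩ := hM
        (interleave qx fun _ => RatCode.halfPow k) x ((1 / 2 : ℝ) ^ k)
        (by rw [interleave_even]; exact hqx) (by rw [interleave_odd]; exact rel_real_halfPow k)
        (by positivity)
      -- With `2⁻ᵗ < ρ' / 2`, the approximate radius minus its error is still positive.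
      obtain ⟨t, ht⟩ := exists_halfPow_lt (half_pos hpos)
      have h1 : dist (ratNum (r (2 * t + 1))) ρ' ≤ (1 / 2 : ℝ) ^ t := hρ' t
      rw [Real.dist_eq] at h1
      have h2 := (abs_le.1 h1).1
      obtain ⟨j, hj⟩ := (hTr (2 * t + 1) _).1 rfl
      obtain ⟨s, hs, hws⟩ := (hstrict j).exists_pos
      -- Three demands on `a i`: `x` lies in its ball of the guaranteed radius, the prefix read for
      -- `x` also starts a name of `a i`, and `B(a i, 2⁻ᵏ)` stays inside `B(x, ε)`.
      obtain ⟨i, hi⟩ := S.dense.exists_dist_lt x (ε := min (ratNum (r (2 * t + 1)) -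
        (1 / 2 : ℝ) ^ t) (min s ((1 / 2 : ℝ) ^ k)))
        (lt_min (by linarith) (lt_min hs (by positivity)))
      obtain ⟨hi1, hi2, hi3⟩ := by simpa only [lt_min_iff] using hi
      have hwi : S.Within (pre qx j) (S.a i) 0 := hws.mono (by linarith)
      obtain ⟨l, hl⟩ := (hTW () (i, pre qx j, k)).1 hwi
      have hd : data (Nat.pair l (Encodable.encode (i, pre qx j, k))) = (i, pre qx j, k) := by
        simp only [data, Nat.unpair_pair, Encodable.encodek, Option.getD_some]
      set n := Nat.pair l (Encodable.encode (i, pre qx j, k)) with hn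
      have hvalid : Valid n := by
        simp only [Valid, hd]
        rw [hn, Nat.unpair_pair]
        exact hl
      -- The machine sees the same first `j` entries as on the name of `x`, hence gives the same
      -- `t`-th approximation of the radius.
      have hpre : pre (centreName (data n)) j =
          pre (interleave qx fun _ => RatCode.halfPow k) j := by
        refine pre_congr fun c hc => ?_
        simp only [hd, centreName, interleave]
        rw [getD_pre qx (show c / 2 < j by omega)]
      have hq : q n (2 * t + 1) = r (2 * t + 1) :=
        ((hK n hvalid).1 _ _).2 ⟨j, by rw [hpre, hj]⟩
      refine Set.mem_biUnion (x := n) ?_ (Set.mem_biUnion (x := n) rfl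
        ((hmem n x).2 ⟨hvalid, t, ?_⟩))
      · refine ((hK n hvalid).2.2.2.2.2.trans ?_).trans hball
        rw [hd]
        refine Metric.ball_subset_ball' ?_
        rw [dist_comm]
        dsimp only
        linarith
      · rw [hq, hd]
        exact hi1
    · refine Set.iUnion₂_subset fun n hn => Set.iUnion₂_subset fun m hm => ?_
      obtain rfl : m = n := hm
      exact (hsub m).trans hn

end ComputableMetricStructure

/-! ### From an effective relatively compact system: names and covers -/

theorem RepSpace.ComputableMap.exists_names {Y : Type*} {δ : RepSpace Y} {f : ℕ → Y}
    (h : ComputableMap nat δ f) : ∃ q : ℕ → ℕ → ℕ, (∀ n, δ.rel (q n) (f n)) ∧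
      ∀ {ι : Type _} (o : ι → ℕ → ℕ), OComp o fun _ (z : ℕ × ℕ) => q z.1 z.2 := by
  obtain ⟨Φ, hΦ, h⟩ := h
  have h' : ∀ n, ∃ q, Transforms Φ (fun _ => n) q ∧ δ.rel q (f n) := fun n => by
    obtain ⟨q, y, hq, hy, rfl⟩ := h (fun _ => n) n rfl trivial
    exact ⟨q, hq, hy⟩
  choose q hT hq using h'
  refine ⟨q, hq, fun o => ?_⟩
  refine ((SemiDec.machine_output (o := o) hΦ (p := fun n _ => n) Primrec.fst).comp
    (f := fun z : (ℕ × ℕ) × ℕ => (z.1.1, z.1.2, z.2)) (by fun_prop)).of_eq fun _ z => ?_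
  exact (hT z.1.1 z.1.2 z.2).symm

theorem OComp.interleave {ι : Type*} {o : ι → ℕ → ℕ} {p q : ι → ℕ → ℕ} (hp : OComp o p)
    (hq : OComp o q) : OComp o fun i => _root_.interleave (p i) (q i) := by
  have hmod : PrimrecPred fun n : ℕ => n % 2 = 0 :=
    PrimrecPred.eq_fun (by fun_prop) (by fun_prop)
  exact OComp.ite (p := fun _ n => n % 2 = 0) (SemiDec.of_primrecPred hmod)
    (SemiDec.of_primrecPred hmod.not)
    (hp.comp_primrec (r := fun n => n / 2) (by fun_prop))
    (hq.comp_primrec (r := fun n => n / 2) (by fun_prop))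

theorem SemiDec.enumerates {ι α : Type*} [Primcodable α] {o : ι → ℕ → ℕ} {q : ι → α × ℕ → ℕ}
    (hq : OComp o q) :
    SemiDec o fun i (z : α × List ℕ) => RepSpace.Enumerates (fun c => q i (z.1, c)) z.2 := by
  refine SemiDec.ex (A := fun i (z : α × List ℕ) c => q i (z.1, c) = Encodable.encode z.2 + 1) ?_
  exact SemiDec.comp hq (f := fun z : (α × List ℕ) × ℕ =>
    ((z.1.1, z.2), Encodable.encode z.1.2 + 1)) (by fun_prop)

theorem enumerates_of_mem_pre {p : ℕ → ℕ} {k : ℕ} {v : List ℕ}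
    (h : Encodable.encode v + 1 ∈ pre p k) : RepSpace.Enumerates p v := by
  obtain ⟨j, -, hj⟩ := List.mem_map.1 h
  exact ⟨j, hj⟩

namespace ComputableMetricStructure

open RepSpace

variable {X : Type*} [MetricSpace X] {S : ComputableMetricStructure X}

/-- Compute a name of the finite union of balls uniformly in the list and wait until the `𝒦`-name of
`B n` enumerates a prefix of it. -/
theorem semiDec_cover {ι : Type*} (o : ι → ℕ → ℕ) {B : ℕ → S.rep.Compacts}
    (hB : ComputableMap nat S.rep.compacts B) :
    SemiDec o fun _ (z : ℕ × List (ℕ × ℕ)) => (B z.1).1 ⊆ (S.ballUnion {b | b ∈ z.2}).1 := by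
  obtain ⟨q, hq, hqc⟩ := hB.exists_names
  obtain ⟨N, hN, hNe⟩ := SemiDec.exists_enumeration (o := o)
    (A := fun _ (L : List (ℕ × ℕ)) v => ∃ b, b ∈ L ∧ S.WordInBall v b) <| by
      refine SemiDec.ex (A := fun _ (z : List (ℕ × ℕ) × List ℕ) b =>
        b ∈ z.1 ∧ S.WordInBall z.2 b) (SemiDec.and ?_ ?_)
      · exact SemiDec.of_primrecPred (PrimrecPred.mem_list (by fun_prop) (by fun_prop))
      · exact semiDec_wordInBall (v := fun z : (List (ℕ × ℕ) × List ℕ) × (ℕ × ℕ) => z.1.2)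
          (c := fun z => z.2.1) (r := fun _ z => _root_.ratNum z.2.2) (by fun_prop)
          (by fun_prop) (OReal.ratNum_primrec (by fun_prop))
  refine (SemiDec.ex (A := fun i (z : ℕ × List (ℕ × ℕ)) w => Enumerates (q z.1) w ∧
    ∀ j < w.length, N i z.2 j = w.getD j 0) (SemiDec.and ?_ ?_)).of_eq fun i z => ?_
  · exact (SemiDec.enumerates (hqc o)).comp
      (f := fun z : (ℕ × List (ℕ × ℕ)) × List ℕ => (z.1.1, z.2)) (by fun_prop)
  · refine SemiDec.forall_lt (f := fun z : (ℕ × List (ℕ × ℕ)) × List ℕ => z.2.length)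
      (A := fun i z j => N i z.1.2 j = z.2.getD j 0) (by fun_prop) ?_
    exact SemiDec.comp hN (f := fun z : ((ℕ × List (ℕ × ℕ)) × List ℕ) × ℕ =>
      ((z.1.1.2, z.2), z.1.2.getD z.2 0)) (by fun_prop)
  · have hrel := hq z.1 (N i z.2) (S.ballUnion {b | b ∈ z.2}) (rel_ballUnion fun v => hNe i z.2 v)
    refine Iff.trans ?_ hrel.symm
    constructor
    · rintro ⟨w, hw, h⟩
      refine ⟨w.length, ?_⟩
      rwa [pre_eq_iff.2 ⟨rfl, fun j hj => (h j hj).symm⟩]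
    · rintro ⟨k, hk⟩
      refine ⟨_, hk, fun j hj => ?_⟩
      rw [length_pre] at hj
      rw [getD_pre _ hj]

theorem oReal_dist_oracle {ι : Type*} {o : ι → ℕ → ℕ} {x : ι → X}
    (hx : ∀ i, S.rep.rel (fun n => o i (2 * n)) (x i)) :
    OReal o fun i (c : ℕ) => dist (x i) (S.a c) := by
  refine OReal.of_approx (τ := fun i z => dist (S.a (o i (2 * z.2))) (S.a z.1)) ?_ ?_
  · exact OReal.subst (q := fun i (z : ℕ × ℕ) => o i (2 * z.2))
      (ρ := fun _ z => dist (S.a z.2) (S.a z.1.1))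
      (OComp.oracle.comp_primrec (by fun_prop))
      ((S.oReal_dist o).comp (f := fun z : (ℕ × ℕ) × ℕ => (z.2, z.1.1)) (by fun_prop))
  · intro i c n
    exact (abs_dist_sub_le _ _ _).trans (hx i n)

theorem oReal_oracle {ι : Type*} {o : ι → ℕ → ℕ} {ε : ι → ℝ}
    (hε : ∀ i, RepSpace.real.rel (fun n => o i (2 * n + 1)) (ε i)) :
    OReal o fun i (_ : Unit) => ε i := by
  refine OReal.of_approx (τ := fun i z => ratNum (o i (2 * z.2 + 1)))
    (OReal.ratNum (OComp.oracle.comp_primrec (by fun_prop))) fun i _ n => ?_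
  have : dist (ratNum (o i (2 * n + 1))) (ε i) ≤ (1 / 2 : ℝ) ^ n := hε i n
  rwa [Real.dist_eq] at this

/-! ### Choosing the radius by nested intervals -/

/-- The interval `(l, u)` is refined to `(l', u')` so that every radius in it settles whether
closed balls around `x`, inside the compact set `K`, meet the ball around `a e` of radius `s`. -/
def Refines (S : ComputableMetricStructure X) (x : X) (K : Set X) (e s s' : ℕ) (l' u' : ℝ) :
    Prop :=
  ¬ ratNum s < ratNum s' ∨
    ((∃ c, dist x (S.a c) < l' ∧ dist (S.a c) (S.a e) < ratNum s') ∨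
      ∃ L : List (ℕ × ℕ), K ⊆ (S.ballUnion {b | b ∈ L}).1 ∧
        ∀ b ∈ L, u' + ratNum b.2 < dist x (S.a b.1) ∨
          ratNum s + ratNum b.2 < dist (S.a b.1) (S.a e))

/-- If a point of `B(a e, s')` is closer to `x` than `u`, so is a dense one, and `l'` can be put
above its distance. Otherwise, for any `u' < u`, each point of `K` is either farther than `u'` from
`x` or at distance at least `s' > s` from `a e`; compactness turns these strict alternatives into a
finite certificate. The gap between `s` and `s'` makes the alternatives overlap. -/
theorem exists_refines (x : X) {K : Set X} (hK : S.rep.IsCompactSet K) (e s s' : ℕ) {l u : ℝ}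
    (hlu : l < u) {δ : ℝ} (hδ : 0 < δ) : ∃ l' u' : ℕ, l < ratNum l' ∧ ratNum l' < ratNum u' ∧
      ratNum u' < u ∧ ratNum u' - ratNum l' < δ ∧ S.Refines x K e s s' (ratNum l') (ratNum u') := by
  by_cases h : ∃ y, dist y (S.a e) < ratNum s' ∧ dist x y < u
  · obtain ⟨y, hy1, hy2⟩ := h
    obtain ⟨c, hc⟩ := S.dense.exists_dist_lt y
      (ε := min (ratNum s' - dist y (S.a e)) (u - dist x y)) (lt_min (by linarith) (by linarith))
    obtain ⟨hc1, hc2⟩ := lt_min_iff.1 hc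
    have h1 := dist_triangle x y (S.a c)
    have h2 := dist_triangle_left (S.a c) (S.a e) y
    obtain ⟨l', hl, hl'⟩ := RatCode.exists_between
      (show max l (dist x (S.a c)) < u from max_lt hlu (by linarith))
    obtain ⟨hl1, hl2⟩ := max_lt_iff.1 hl
    obtain ⟨u', hu, hu'⟩ := RatCode.exists_between
      (show ratNum l' < min u (ratNum l' + δ) from lt_min hl' (by linarith))
    obtain ⟨hu1, hu2⟩ := lt_min_iff.1 hu'
    exact ⟨l', u', hl1, hu, hu1, by linarith, Or.inr (Or.inl ⟨c, hl2, by linarith⟩)⟩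
  · push Not at h
    obtain ⟨u', hu, hu'⟩ := RatCode.exists_between hlu
    obtain ⟨l', hl, hl'⟩ := RatCode.exists_between
      (show max l (ratNum u' - δ) < ratNum u' from max_lt hu (by linarith))
    obtain ⟨hl1, hl2⟩ := max_lt_iff.1 hl
    refine ⟨l', u', hl1, hl', hu', by linarith, ?_⟩
    by_cases hs : ratNum s < ratNum s'
    swap
    · exact Or.inl hs
    obtain ⟨L, hLP, hL⟩ := exists_finite_subcover hK
      (P := {b | ratNum u' + ratNum b.2 < dist x (S.a b.1) ∨
        ratNum s + ratNum b.2 < dist (S.a b.1) (S.a e)}) fun y _ => by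
      rcases lt_or_ge (dist y (S.a e)) (ratNum s') with hy | hy
      · have := h y hy
        refine mem_ballUnion_of_small (show 0 < dist x y - ratNum u' by linarith)
          fun b _ hb => Or.inl ?_
        have := dist_triangle_right x y (S.a b.1)
        linarith
      · refine mem_ballUnion_of_small (show 0 < ratNum s' - ratNum s by linarith)
          fun b _ hb => Or.inr ?_
        have := dist_triangle y (S.a b.1) (S.a e)
        linarith
    exact Or.inr (Or.inr ⟨L, hL, hLP⟩)

theorem semiDec_refines {ι : Type*} {o : ι → ℕ → ℕ} {x : ι → X}
    (hx : OReal o fun i (c : ℕ) => dist (x i) (S.a c)) {B : ℕ → S.rep.Compacts}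
    (hB : ComputableMap nat S.rep.compacts B) :
    SemiDec o fun i (z : (ℕ × ℕ × ℕ × ℕ) × (ℕ × ℕ)) =>
      S.Refines (x i) (B z.1.1).1 z.1.2.1 z.1.2.2.1 z.1.2.2.2 (ratNum z.2.1) (ratNum z.2.2) := by
  refine SemiDec.or (SemiDec.of_primrecPred (RatCode.primrecPred_lt
    (by fun_prop) (by fun_prop)).not) (SemiDec.or ?_ ?_)
  · refine SemiDec.ex (A := fun i (z : (ℕ × ℕ × ℕ × ℕ) × (ℕ × ℕ)) c =>
      dist (x i) (S.a c) < ratNum z.2.1 ∧ dist (S.a c) (S.a z.1.2.1) < ratNum z.1.2.2.2)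
      (SemiDec.and (SemiDec.lt (hx.comp Primrec.snd) (OReal.ratNum_primrec (by fun_prop)))
        (SemiDec.lt ?_ (OReal.ratNum_primrec (by fun_prop))))
    exact (S.oReal_dist o).comp (f := fun z : ((ℕ × ℕ × ℕ × ℕ) × (ℕ × ℕ)) × ℕ =>
      (z.2, z.1.1.2.1)) (by fun_prop)
  · refine SemiDec.ex (A := fun i (z : (ℕ × ℕ × ℕ × ℕ) × (ℕ × ℕ)) (L : List (ℕ × ℕ)) =>
      (B z.1.1).1 ⊆ (S.ballUnion {b | b ∈ L}).1 ∧
        ∀ b ∈ L, ratNum z.2.2 + ratNum b.2 < dist (x i) (S.a b.1) ∨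
          ratNum z.1.2.2.1 + ratNum b.2 < dist (S.a b.1) (S.a z.1.2.1)) (SemiDec.and ?_ ?_)
    · exact (semiDec_cover o hB).comp
        (f := fun z : ((ℕ × ℕ × ℕ × ℕ) × (ℕ × ℕ)) × List (ℕ × ℕ) => (z.1.1.1, z.2)) (by fun_prop)
    · refine SemiDec.forall_mem
        (l := fun z : ((ℕ × ℕ × ℕ × ℕ) × (ℕ × ℕ)) × List (ℕ × ℕ) => z.2)
        (A := fun i z b => ratNum z.1.2.2 + ratNum b.2 < dist (x i) (S.a b.1) ∨
          ratNum z.1.1.2.2.1 + ratNum b.2 < dist (S.a b.1) (S.a z.1.1.2.1)) (by fun_prop)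
        (SemiDec.or ?_ ?_)
      · exact SemiDec.lt (OReal.add (OReal.ratNum_primrec (by fun_prop))
          (OReal.ratNum_primrec (by fun_prop)))
          (hx.comp (f := fun z : (((ℕ × ℕ × ℕ × ℕ) × (ℕ × ℕ)) × List (ℕ × ℕ)) × (ℕ × ℕ) =>
            z.2.1) (by fun_prop))
      · exact SemiDec.lt (OReal.add (OReal.ratNum_primrec (by fun_prop))
          (OReal.ratNum_primrec (by fun_prop)))
          ((S.oReal_dist o).comp
            (f := fun z : (((ℕ × ℕ × ℕ × ℕ) × (ℕ × ℕ)) × List (ℕ × ℕ)) × (ℕ × ℕ) =>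
              (z.2.1, z.1.1.1.2.1)) (by fun_prop))

/-- Refinement of the interval settles the questions for a radius inside it. -/
theorem Refines.dichotomy {x : X} {K : Set X} {e s s' : ℕ} {l' u' ρ : ℝ}
    (h : S.Refines x K e s s' l' u') (hs : ratNum s < ratNum s') (hl : l' < ρ) (hu : ρ < u')
    (hK : Metric.closedBall x ρ ⊆ K) :
    (∃ c, dist x (S.a c) < ρ ∧ dist (S.a c) (S.a e) < ratNum s') ∨
      ∀ y ∈ Metric.closedBall x ρ, ratNum s < dist y (S.a e) := by
  rcases h with h | ⟨c, hc, hc'⟩ | ⟨L, hL, h⟩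
  · exact absurd hs h
  · exact Or.inl ⟨c, hc.trans hl, hc'⟩
  · refine Or.inr fun y hy => ?_
    obtain ⟨b, hb, hyb⟩ := mem_ballUnion.1 (hL (hK hy))
    rw [Metric.mem_closedBall, dist_comm] at hy
    rcases h b hb with h | h
    · have := dist_triangle x y (S.a b.1)
      linarith
    · have := dist_triangle_left (S.a b.1) (S.a e) y
      linarith

/-- Intervals with rational end points that shrink to a radius `ρ` for which the closed ball
around `x` is compact, as a subset of the `n`-th compact set, and overt. -/
structure IsRadiusApprox (S : ComputableMetricStructure X) (B : ℕ → S.rep.Compacts) (x : X)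
    (ε : ℝ) (σ : ℕ → ℕ × ℕ × ℕ) (n : ℕ) (ρ : ℝ) : Prop where
  index : ∀ j, (σ j).1 = n
  lower : ∀ j, ratNum (σ j).2.1 < ρ
  upper : ∀ j, ρ < ratNum (σ j).2.2
  width : ∀ j, ratNum (σ (j + 1)).2.2 - ratNum (σ (j + 1)).2.1 < (1 / 2 : ℝ) ^ j
  pos : 0 < ρ
  closedBall_subset : Metric.closedBall x ρ ⊆ (B n).1
  subset_ball : (B n).1 ⊆ Metric.ball x ε
  exists_dense : ∀ V : Set X, IsOpen V → (Metric.closedBall x ρ ∩ V).Nonempty →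
    ∃ c, dist x (S.a c) < ρ ∧ S.a c ∈ V

/-- The radius is the supremum of the lower end points; strict nesting keeps it strictly inside
every interval. Stage `j` settles the question coded by `j`, so every triple `(e, s, s')` is
treated. -/
theorem isRadiusApprox_of_refines {B : ℕ → S.rep.Compacts} {x : X} {ε : ℝ} {n k : ℕ}
    (hk : Metric.closedBall x ((1 / 2 : ℝ) ^ k) ⊆ (B n).1) (hn : (B n).1 ⊆ Metric.ball x ε)
    {σ : ℕ → ℕ × ℕ × ℕ} (h0 : σ 0 = (n, RatCode.halfPow (k + 1), RatCode.halfPow k))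
    (hσ : ∀ j, ratNum (σ j).2.1 < ratNum (σ j).2.2 → (σ (j + 1)).1 = (σ j).1 ∧
      ratNum (σ j).2.1 < ratNum (σ (j + 1)).2.1 ∧
      ratNum (σ (j + 1)).2.1 < ratNum (σ (j + 1)).2.2 ∧
      ratNum (σ (j + 1)).2.2 < ratNum (σ j).2.2 ∧
      ratNum (σ (j + 1)).2.2 - ratNum (σ (j + 1)).2.1 < (1 / 2 : ℝ) ^ j ∧
      S.Refines x (B (σ j).1).1 j.unpair.1 j.unpair.2.unpair.1 j.unpair.2.unpair.2
        (ratNum (σ (j + 1)).2.1) (ratNum (σ (j + 1)).2.2)) :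
    ∃ ρ, S.IsRadiusApprox B x ε σ n ρ := by
  have hinv : ∀ j, (σ j).1 = n ∧ ratNum (σ j).2.1 < ratNum (σ j).2.2 := by
    intro j
    induction j with
    | zero =>
      rw [h0]
      simp only [RatCode.ratNum_halfPow, true_and]
      exact pow_lt_pow_right_of_lt_one₀ (by norm_num) (by norm_num) (Nat.lt_succ_self k)
    | succ j ih =>
      have := hσ j ih.2
      exact ⟨this.1.trans ih.1, this.2.2.1⟩
  have hstep := fun j => hσ j (hinv j).2
  have hmono : StrictMono fun j => ratNum (σ j).2.1 :=
    strictMono_nat_of_lt_succ fun j => (hstep j).2.1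
  have hanti : StrictAnti fun j => ratNum (σ j).2.2 :=
    strictAnti_nat_of_succ_lt fun j => (hstep j).2.2.2.1
  have hle : ∀ i j, ratNum (σ i).2.1 ≤ ratNum (σ j).2.2 := fun i j =>
    (hmono.monotone (le_max_left i j)).trans
      ((hinv _).2.le.trans (hanti.antitone (le_max_right i j)))
  have hbdd : BddAbove (Set.range fun j => ratNum (σ j).2.1) :=
    ⟨_, Set.forall_mem_range.2 fun i => hle i 0⟩
  let ρ := ⨆ j, ratNum (σ j).2.1
  have hlow : ∀ j, ratNum (σ j).2.1 < ρ := fun j =>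
    (hmono (Nat.lt_succ_self j)).trans_le (le_ciSup hbdd (j + 1))
  have hupp : ∀ j, ρ < ratNum (σ j).2.2 := fun j =>
    (ciSup_le fun i => hle i (j + 1)).trans_lt (hanti (Nat.lt_succ_self j))
  have hball : Metric.closedBall x ρ ⊆ (B n).1 := by
    refine (Metric.closedBall_subset_closedBall ?_).trans hk
    have := hupp 0
    rw [h0, RatCode.ratNum_halfPow] at this
    exact this.le
  refine ⟨ρ, fun j => (hinv j).1, hlow, hupp, fun j => (hstep j).2.2.2.2.1, ?_, hball, hn, ?_⟩
  · have := hlow 0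
    rw [h0, RatCode.ratNum_halfPow] at this
    exact lt_trans (by positivity) this
  · rintro V hV ⟨y, hy, hyV⟩
    obtain ⟨η, hη, hηV⟩ := Metric.isOpen_iff.1 hV y hyV
    -- Choosing `η / 3 < s < s' < η / 2` excludes the avoiding alternative, because `y` itself is
    -- within `s` of `a e`; in the other one the dense point is closer to `y` than `η / 2 + η / 3 <
    -- η`.
    obtain ⟨e, he⟩ := S.dense.exists_dist_lt y (ε := η / 3) (by linarith)
    obtain ⟨s', hs1, hs2⟩ := RatCode.exists_between (show η / 3 < η / 2 by linarith)
    obtain ⟨s, hs3, hs4⟩ := RatCode.exists_between hs1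
    have hj := (hstep (Nat.pair e (Nat.pair s s'))).2.2.2.2.2
    simp only [Nat.unpair_pair, (hinv _).1] at hj
    rcases hj.dichotomy hs4 (hlow _) (hupp _) hball with ⟨c, hc, hc'⟩ | h
    · refine ⟨c, hc, hηV ?_⟩
      rw [Metric.mem_ball]
      have := dist_triangle_right (S.a c) y (S.a e)
      linarith
    · have := h y hy
      linarith

theorem exists_radiusApprox {ι : Type*} {o : ι → ℕ → ℕ} {x : ι → X} {ε : ι → ℝ}
    (hx : OReal o fun i (c : ℕ) => dist (x i) (S.a c)) (hε : OReal o fun i (_ : Unit) => ε i)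
    (hpos : ∀ i, 0 < ε i) {U : ℕ → S.rep.Opens} {B : ℕ → S.rep.Compacts} {R : Set (ℕ × ℕ)}
    (h : S.rep.IsErcs U B R) :
    ∃ σ : ι → ℕ → ℕ × ℕ × ℕ, OComp o σ ∧ ∀ i, ∃ n ρ, S.IsRadiusApprox B (x i) (ε i) (σ i) n ρ := by
  obtain ⟨qU, hqU, hqUc⟩ := h.computable_opens.exists_names
  -- Search for `(n, k)` together with certificates for `closedBall x 2⁻ᵏ ⊆ U m`, for `(m, n) ∈ R`,
  -- and for `B n ⊆ B(x, ε)`; the last is a finite cover by balls formally inside `B(x, ε)`. Such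
  -- data exist by the system's covering property for `B(x, ε)`.
  obtain ⟨q, hq, hqs⟩ := SemiDec.choose (o := o) (α := Unit) (β := ℕ × ℕ)
    (A := fun i _ y => ∃ m, (m, y.1) ∈ R ∧
      ((∃ v, Enumerates (qU m) v ∧ S.Within v (x i) ((1 / 2 : ℝ) ^ y.2)) ∧
      ∃ L : List (ℕ × ℕ), (B y.1).1 ⊆ (S.ballUnion {b | b ∈ L}).1 ∧
        ∀ b ∈ L, dist (x i) (S.a b.1) + ratNum b.2 < ε i)) (by
      refine SemiDec.ex (A := fun i (z : Unit × (ℕ × ℕ)) m => (m, z.2.1) ∈ R ∧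
        ((∃ v, Enumerates (qU m) v ∧ S.Within v (x i) ((1 / 2 : ℝ) ^ z.2.2)) ∧
        ∃ L : List (ℕ × ℕ), (B z.2.1).1 ⊆ (S.ballUnion {b | b ∈ L}).1 ∧
          ∀ b ∈ L, dist (x i) (S.a b.1) + ratNum b.2 < ε i))
        (SemiDec.and ?_ (SemiDec.and ?_ ?_))
      · exact (SemiDec.of_re h.ce).comp (f := fun z : (Unit × (ℕ × ℕ)) × ℕ => (z.2, z.1.2.1))
          (by fun_prop)
      · refine SemiDec.ex (A := fun i (z : (Unit × (ℕ × ℕ)) × ℕ) v =>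
          Enumerates (qU z.2) v ∧ S.Within v (x i) ((1 / 2 : ℝ) ^ z.1.2.2)) (SemiDec.and ?_ ?_)
        · exact (SemiDec.enumerates (hqUc o)).comp
            (f := fun z : ((Unit × (ℕ × ℕ)) × ℕ) × List ℕ => (z.1.2, z.2)) (by fun_prop)
        · exact semiDec_within (v := fun z : ((Unit × (ℕ × ℕ)) × ℕ) × List ℕ => z.2)
            (y := fun i _ => x i) (by fun_prop) (hx.comp Primrec.snd)
            (OReal.halfPow (by fun_prop))
      · refine SemiDec.ex (A := fun i (z : (Unit × (ℕ × ℕ)) × ℕ) (L : List (ℕ × ℕ)) =>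
          (B z.1.2.1).1 ⊆ (S.ballUnion {b | b ∈ L}).1 ∧
            ∀ b ∈ L, dist (x i) (S.a b.1) + ratNum b.2 < ε i) (SemiDec.and ?_ ?_)
        · exact (semiDec_cover o h.computable_compacts).comp
            (f := fun z : ((Unit × (ℕ × ℕ)) × ℕ) × List (ℕ × ℕ) => (z.1.1.2.1, z.2)) (by fun_prop)
        · refine SemiDec.forall_mem (l := fun z : ((Unit × (ℕ × ℕ)) × ℕ) × List (ℕ × ℕ) => z.2)
            (A := fun i _ b => dist (x i) (S.a b.1) + ratNum b.2 < ε i) (by fun_prop)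
            (SemiDec.lt (OReal.add ?_ (OReal.ratNum_primrec (by fun_prop)))
              (hε.comp (Primrec.const ())))
          exact hx.comp (f := fun z : (((Unit × (ℕ × ℕ)) × ℕ) × List (ℕ × ℕ)) × (ℕ × ℕ) => z.2.1)
            (by fun_prop)) (by
      intro i _
      have hxi : x i ∈ Metric.ball (x i) (ε i) := Metric.mem_ball_self (hpos i)
      have hW := h.eq_iUnion ⟨Metric.ball (x i) (ε i), isOpenSet_of_isOpen Metric.isOpen_ball⟩
      dsimp only at hW
      rw [hW] at hxi
      simp only [Set.mem_iUnion, Set.mem_ofPred_eq, exists_prop] at hxi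
      obtain ⟨n, hn, m, hm, hxm⟩ := hxi
      obtain ⟨v, hv, r, hr, hvr⟩ := exists_within_of_mem (hqU m) hxm
      obtain ⟨k, hk⟩ := exists_halfPow_lt hr
      obtain ⟨L, hLP, hL⟩ := exists_finite_subcover (B n).2.2
        (P := {b | dist (x i) (S.a b.1) + ratNum b.2 < ε i}) fun y hy => by
        have hy' := Metric.mem_ball.1 (hn hy)
        refine mem_ballUnion_of_small (show 0 < ε i - dist y (x i) by linarith) fun b _ hb => ?_
        have := dist_triangle_left (x i) (S.a b.1) y
        change dist (x i) (S.a b.1) + ratNum b.2 < ε i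
        linarith
      refine ⟨(n, k), m, hm, ⟨v, hv, hvr.mono ?_⟩, L, hL, hLP⟩
      rw [dist_self]
      linarith)
  -- The first alternative makes the relation total, as `SemiDec.choose` requires; along the actual
  -- iteration the intervals are nonempty and it never occurs.
  let Step : ι → ℕ × (ℕ × ℕ × ℕ) → ℕ × ℕ × ℕ → Prop := fun i z y =>
    ¬ ratNum z.2.2.1 < ratNum z.2.2.2 ∨ (y.1 = z.2.1 ∧ ratNum z.2.2.1 < ratNum y.2.1 ∧
      ratNum y.2.1 < ratNum y.2.2 ∧ ratNum y.2.2 < ratNum z.2.2.2 ∧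
      ratNum y.2.2 - ratNum y.2.1 < (1 / 2 : ℝ) ^ z.1 ∧
      S.Refines (x i) (B z.2.1).1 z.1.unpair.1 z.1.unpair.2.unpair.1 z.1.unpair.2.unpair.2
        (ratNum y.2.1) (ratNum y.2.2))
  obtain ⟨g, hg, hgs⟩ := SemiDec.choose (o := o) (A := Step) (by
      refine SemiDec.or (SemiDec.of_primrecPred
        (RatCode.primrecPred_lt (by fun_prop) (by fun_prop)).not)
        (SemiDec.and (SemiDec.of_primrecPred (PrimrecPred.eq_fun (by fun_prop) (by fun_prop)))
        (SemiDec.and (SemiDec.of_primrecPred (RatCode.primrecPred_lt (by fun_prop) (by fun_prop)))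
        (SemiDec.and (SemiDec.of_primrecPred (RatCode.primrecPred_lt (by fun_prop) (by fun_prop)))
        (SemiDec.and (SemiDec.of_primrecPred (RatCode.primrecPred_lt (by fun_prop) (by fun_prop)))
        (SemiDec.and (SemiDec.lt (OReal.sub (OReal.ratNum_primrec (by fun_prop))
          (OReal.ratNum_primrec (by fun_prop))) (OReal.halfPow (by fun_prop))) ?_)))))
      exact (semiDec_refines hx h.computable_compacts).comp
        (f := fun z : (ℕ × (ℕ × ℕ × ℕ)) × (ℕ × ℕ × ℕ) =>
          ((z.1.2.1, z.1.1.unpair.1, z.1.1.unpair.2.unpair.1, z.1.1.unpair.2.unpair.2),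
            (z.2.2.1, z.2.2.2))) (by fun_prop)) (by
      rintro i ⟨j, n, l, u⟩
      by_cases hlu : ratNum l < ratNum u
      · obtain ⟨l', u', h1, h2, h3, h4, h5⟩ := exists_refines (S := S) (x i) (B n).2.2 j.unpair.1
          j.unpair.2.unpair.1 j.unpair.2.unpair.2 hlu
          (show (0 : ℝ) < (1 / 2) ^ j by positivity)
        exact ⟨(n, l', u'), Or.inr ⟨rfl, h1, h2, h3, h4, h5⟩⟩
      · exact ⟨(n, l, u), Or.inl hlu⟩)
  let init : ι → ℕ × ℕ × ℕ := fun i =>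
    ((q i ()).1, RatCode.halfPow ((q i ()).2 + 1), RatCode.halfPow (q i ()).2)
  let σ : ι → ℕ → ℕ × ℕ × ℕ := fun i => Nat.rec (init i) fun j y => g i (j, y)
  have hinit : OComp o fun i (_ : Unit) => init i :=
    (OComp.of_primrec (f := fun y : ℕ × ℕ =>
      (y.1, RatCode.halfPow (y.2 + 1), RatCode.halfPow y.2)) (by fun_prop)).comp hq
  refine ⟨σ, OComp.iterate hinit hg (fun _ => rfl) (fun _ _ => rfl), fun i => ?_⟩
  obtain ⟨m, hm, ⟨v, hv, hvx⟩, L, hL, hLε⟩ := hqs i ()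
  refine ⟨(q i ()).1, isRadiusApprox_of_refines (k := (q i ()).2) ?_ ?_ rfl fun j hj => ?_⟩
  · refine Set.Subset.trans (fun y hy => ?_) (h.subset_of_mem _ _ hm)
    exact hvx.mem_of_enumerates (Metric.mem_closedBall.1 hy) (hqU m) hv
  · intro y hy
    obtain ⟨b, hb, hyb⟩ := mem_ballUnion.1 (hL hy)
    have := hLε b hb
    rw [Metric.mem_ball]
    have := dist_triangle_right y (x i) (S.a b.1)
    linarith
  · rcases hgs i (j, σ i j) with h' | h'
    · exact absurd hj h'
    · exact h'

/-! ### The constructed ball as a compact and overt set -/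

/-- Certificates that the closed ball around `x` is contained in an open set whose name starts
with `z`. -/
def CoverCert (S : ComputableMetricStructure X) (B : ℕ → S.rep.Compacts) (x : X)
    (σ : ℕ → ℕ × ℕ × ℕ) (z : List ℕ) : Prop :=
  ∃ j, ∃ L : List (ℕ × ℕ), (B (σ j).1).1 ⊆ (S.ballUnion {b | b ∈ L}).1 ∧
    ∀ b ∈ L, ratNum (σ j).2.2 + ratNum b.2 < dist x (S.a b.1) ∨
      ∃ v : List ℕ, Encodable.encode v + 1 ∈ z ∧ S.Within v (S.a b.1) (ratNum b.2)

/-- Certificates that the closed ball around `x` meets an open set whose name starts with `z`. -/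
def MeetCert (S : ComputableMetricStructure X) (x : X) (σ : ℕ → ℕ × ℕ × ℕ) (z : List ℕ) : Prop :=
  ∃ c j, dist x (S.a c) < ratNum (σ j).2.1 ∧
    ∃ v : List ℕ, Encodable.encode v + 1 ∈ z ∧ S.Within v (S.a c) 0

theorem semiDec_coverCert {ι : Type*} {o : ι → ℕ → ℕ} {x : ι → X}
    (hx : OReal o fun i (c : ℕ) => dist (x i) (S.a c)) {B : ℕ → S.rep.Compacts}
    (hB : ComputableMap nat S.rep.compacts B) {σ : ι → ℕ → ℕ × ℕ × ℕ} (hσ : OComp o σ) :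
    SemiDec o fun i (z : Unit × List ℕ) => S.CoverCert B (x i) (σ i) z.2 := by
  refine SemiDec.ex (A := fun i (z : Unit × List ℕ) j => ∃ L : List (ℕ × ℕ),
    (B (σ i j).1).1 ⊆ (S.ballUnion {b | b ∈ L}).1 ∧
      ∀ b ∈ L, ratNum (σ i j).2.2 + ratNum b.2 < dist (x i) (S.a b.1) ∨
      ∃ v : List ℕ, Encodable.encode v + 1 ∈ z.2 ∧ S.Within v (S.a b.1) (ratNum b.2)) ?_
  refine SemiDec.subst (q := fun i (z : (Unit × List ℕ) × ℕ) => σ i z.2)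
    (A := fun i z y => ∃ L : List (ℕ × ℕ), (B y.1).1 ⊆ (S.ballUnion {b | b ∈ L}).1 ∧
      ∀ b ∈ L, ratNum y.2.2 + ratNum b.2 < dist (x i) (S.a b.1) ∨
      ∃ v : List ℕ, Encodable.encode v + 1 ∈ z.1.2 ∧ S.Within v (S.a b.1) (ratNum b.2))
    (hσ.comp_primrec Primrec.snd) ?_
  refine SemiDec.ex (A := fun i (z : ((Unit × List ℕ) × ℕ) × (ℕ × ℕ × ℕ)) (L : List (ℕ × ℕ)) =>
    (B z.2.1).1 ⊆ (S.ballUnion {b | b ∈ L}).1 ∧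
      ∀ b ∈ L, ratNum z.2.2.2 + ratNum b.2 < dist (x i) (S.a b.1) ∨
      ∃ v : List ℕ, Encodable.encode v + 1 ∈ z.1.1.2 ∧ S.Within v (S.a b.1) (ratNum b.2))
    (SemiDec.and ?_ ?_)
  · exact (semiDec_cover o hB).comp
      (f := fun z : (((Unit × List ℕ) × ℕ) × (ℕ × ℕ × ℕ)) × List (ℕ × ℕ) => (z.1.2.1, z.2))
      (by fun_prop)
  · refine SemiDec.forall_mem
      (l := fun z : (((Unit × List ℕ) × ℕ) × (ℕ × ℕ × ℕ)) × List (ℕ × ℕ) => z.2)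
      (A := fun i z b => ratNum z.1.2.2.2 + ratNum b.2 < dist (x i) (S.a b.1) ∨
        ∃ v : List ℕ, Encodable.encode v + 1 ∈ z.1.1.1.2 ∧ S.Within v (S.a b.1) (ratNum b.2))
      (by fun_prop) (SemiDec.or ?_ ?_)
    · exact SemiDec.lt (OReal.add (OReal.ratNum_primrec (by fun_prop))
        (OReal.ratNum_primrec (by fun_prop)))
        (hx.comp (f := fun z : ((((Unit × List ℕ) × ℕ) × (ℕ × ℕ × ℕ)) × List (ℕ × ℕ)) × (ℕ × ℕ) =>
          z.2.1) (by fun_prop))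
    · refine SemiDec.ex (A := fun i
        (z : ((((Unit × List ℕ) × ℕ) × (ℕ × ℕ × ℕ)) × List (ℕ × ℕ)) × (ℕ × ℕ)) (v : List ℕ) =>
        Encodable.encode v + 1 ∈ z.1.1.1.1.2 ∧ S.Within v (S.a z.2.1) (ratNum z.2.2))
        (SemiDec.and (SemiDec.of_primrecPred (PrimrecPred.mem_list (by fun_prop) (by fun_prop)))
        ?_)
      refine semiDec_within (v := fun z :
        (((((Unit × List ℕ) × ℕ) × (ℕ × ℕ × ℕ)) × List (ℕ × ℕ)) × (ℕ × ℕ)) × List ℕ => z.2)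
        (y := fun _ z => S.a z.1.2.1) (by fun_prop) ?_ (OReal.ratNum_primrec (by fun_prop))
      exact (S.oReal_dist o).comp (f := fun z :
        ((((((Unit × List ℕ) × ℕ) × (ℕ × ℕ × ℕ)) × List (ℕ × ℕ)) × (ℕ × ℕ)) × List ℕ) × ℕ =>
          (z.1.1.2.1, z.2)) (by fun_prop)

theorem semiDec_meetCert {ι : Type*} {o : ι → ℕ → ℕ} {x : ι → X}
    (hx : OReal o fun i (c : ℕ) => dist (x i) (S.a c)) {σ : ι → ℕ → ℕ × ℕ × ℕ}
    (hσ : OComp o σ) : SemiDec o fun i (z : Unit × List ℕ) => S.MeetCert (x i) (σ i) z.2 := by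
  refine SemiDec.ex (A := fun i (z : Unit × List ℕ) c => ∃ j,
    dist (x i) (S.a c) < ratNum (σ i j).2.1 ∧
      ∃ v : List ℕ, Encodable.encode v + 1 ∈ z.2 ∧ S.Within v (S.a c) 0) ?_
  refine SemiDec.ex (A := fun i (z : (Unit × List ℕ) × ℕ) j =>
    dist (x i) (S.a z.2) < ratNum (σ i j).2.1 ∧
      ∃ v : List ℕ, Encodable.encode v + 1 ∈ z.1.2 ∧ S.Within v (S.a z.2) 0) (SemiDec.and ?_ ?_)
  · refine SemiDec.lt (hx.comp (f := fun z : ((Unit × List ℕ) × ℕ) × ℕ => z.1.2) (by fun_prop))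
      (OReal.ratNum ?_)
    exact (OComp.of_primrec (f := fun y : ℕ × ℕ × ℕ => y.2.1) (by fun_prop)).comp
      (hσ.comp_primrec (r := fun z : ((Unit × List ℕ) × ℕ) × ℕ => z.2) (by fun_prop))
  · refine SemiDec.ex (A := fun i (z : ((Unit × List ℕ) × ℕ) × ℕ) (v : List ℕ) =>
      Encodable.encode v + 1 ∈ z.1.1.2 ∧ S.Within v (S.a z.1.2) 0)
      (SemiDec.and (SemiDec.of_primrecPred (PrimrecPred.mem_list (by fun_prop) (by fun_prop))) ?_)
    refine semiDec_within (v := fun z : (((Unit × List ℕ) × ℕ) × ℕ) × List ℕ => z.2)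
      (y := fun _ z => S.a z.1.1.2) (by fun_prop) ?_ OReal.zero
    exact (S.oReal_dist o).comp (f := fun z :
      ((((Unit × List ℕ) × ℕ) × ℕ) × List ℕ) × ℕ => (z.1.1.1.2, z.2)) (by fun_prop)

namespace IsRadiusApprox

variable {B : ℕ → S.rep.Compacts} {x : X} {ε : ℝ} {σ : ℕ → ℕ × ℕ × ℕ} {n : ℕ} {ρ : ℝ}

theorem rel_real (h : S.IsRadiusApprox B x ε σ n ρ) :
    RepSpace.real.rel (fun j => (σ (j + 1)).2.1) ρ := by
  intro j
  rw [Real.dist_eq, abs_le]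
  have h1 := h.lower (j + 1)
  have h2 := h.upper (j + 1)
  have h3 := h.width j
  constructor <;> linarith

theorem eventually_lt_lower (h : S.IsRadiusApprox B x ε σ n ρ) {r : ℝ} (hr : r < ρ) :
    ∀ᶠ j in Filter.atTop, r < ratNum (σ j).2.1 := by
  obtain ⟨N, hN⟩ := exists_halfPow_lt (sub_pos.2 hr)
  filter_upwards [Filter.eventually_ge_atTop (N + 1)] with j hj
  obtain ⟨j, rfl⟩ : ∃ k, j = k + 1 := ⟨j - 1, by omega⟩
  have h1 := h.upper (j + 1)
  have h2 := h.width j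
  have h3 : (1 / 2 : ℝ) ^ j ≤ (1 / 2 : ℝ) ^ N :=
    pow_le_pow_of_le_one (by norm_num) (by norm_num) (by omega)
  linarith

theorem eventually_upper_lt (h : S.IsRadiusApprox B x ε σ n ρ) {r : ℝ} (hr : ρ < r) :
    ∀ᶠ j in Filter.atTop, ratNum (σ j).2.2 < r := by
  obtain ⟨N, hN⟩ := exists_halfPow_lt (sub_pos.2 hr)
  filter_upwards [Filter.eventually_ge_atTop (N + 1)] with j hj
  obtain ⟨j, rfl⟩ : ∃ k, j = k + 1 := ⟨j - 1, by omega⟩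
  have h1 := h.lower (j + 1)
  have h2 := h.width j
  have h3 : (1 / 2 : ℝ) ^ j ≤ (1 / 2 : ℝ) ^ N :=
    pow_le_pow_of_le_one (by norm_num) (by norm_num) (by omega)
  linarith

/-- The cover is taken of `B n`, not of the ball: points of `B n` outside the ball are covered by
rational balls that visibly miss it. The finitely many conditions on the cover all hold from some
stage on, since the upper end points tend to `ρ` and the prefix of the name grows. -/
theorem subset_iff (h : S.IsRadiusApprox B x ε σ n ρ) {p : ℕ → ℕ} {V : S.rep.Opens}
    (hp : S.rep.opens.rel p V) :
    Metric.closedBall x ρ ⊆ V.1 ↔ ∃ k, S.CoverCert B x σ (pre p k) := by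
  constructor
  · intro hV
    obtain ⟨L, hLP, hL⟩ := exists_finite_subcover (B n).2.2
      (P := {b | ρ + ratNum b.2 < dist x (S.a b.1) ∨
        ∃ v, Enumerates p v ∧ S.Within v (S.a b.1) (ratNum b.2)}) fun y _ => by
      rcases le_or_gt (dist y x) ρ with hy | hy
      · obtain ⟨v, hv, r, hr, hvr⟩ := exists_within_of_mem hp (hV (Metric.mem_closedBall.2 hy))
        exact mem_ballUnion_of_small hr fun b _ hb => Or.inr ⟨v, hv, hvr.mono hb.le⟩
      · refine mem_ballUnion_of_small (sub_pos.2 hy) fun b _ hb => Or.inl ?_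
        have := dist_triangle_right y x (S.a b.1)
        linarith
    have hev : ∀ᶠ j in Filter.atTop, ∀ b ∈ L,
        ratNum (σ j).2.2 + ratNum b.2 < dist x (S.a b.1) ∨
        ∃ v : List ℕ, Encodable.encode v + 1 ∈ pre p j ∧
          S.Within v (S.a b.1) (ratNum b.2) := by
      refine (Filter.eventually_all_finite (List.finite_toSet L)).2 fun b hb => ?_
      rcases hLP b hb with hb | ⟨v, ⟨i, hi⟩, hv⟩
      · filter_upwards [h.eventually_upper_lt (r := dist x (S.a b.1) - ratNum b.2) (by linarith)]
          with j hj
        exact Or.inl (by linarith)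
      · filter_upwards [Filter.eventually_gt_atTop i] with j hj
        exact Or.inr ⟨v, List.mem_map.2 ⟨i, List.mem_range.2 hj, hi⟩, hv⟩
    obtain ⟨j, hj⟩ := hev.exists
    exact ⟨j, j, L, by rwa [h.index], hj⟩
  · rintro ⟨k, j, L, hL, hcert⟩ y hy
    rw [h.index] at hL
    obtain ⟨b, hb, hyb⟩ := mem_ballUnion.1 (hL (h.closedBall_subset hy))
    rcases hcert b hb with hc | ⟨v, hv, hvb⟩
    · have h1 := Metric.mem_closedBall.1 hy
      have h2 := h.upper j
      have h3 := dist_triangle_left x (S.a b.1) y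
      linarith
    · exact hvb.mem_of_enumerates hyb.le hp (enumerates_of_mem_pre hv)

/-- By the choice of the radius, meeting the closed ball is witnessed by a dense point of the open
ball, and both membership of that point in `V` and its distance bound are semidecidable. -/
theorem meets_iff (h : S.IsRadiusApprox B x ε σ n ρ) {p : ℕ → ℕ} {V : S.rep.Opens}
    (hp : S.rep.opens.rel p V) :
    (Metric.closedBall x ρ ∩ V.1).Nonempty ↔ ∃ k, S.MeetCert x σ (pre p k) := by
  constructor
  · intro hV
    obtain ⟨c, hc, hcV⟩ := h.exists_dense V.1 (isOpen_of_isOpenSet V.2) hV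
    obtain ⟨v, ⟨i, hi⟩, r, hr, hvr⟩ := exists_within_of_mem hp hcV
    obtain ⟨j, hj⟩ := (h.eventually_lt_lower hc).exists
    refine ⟨i + 1, c, j, hj, v, List.mem_map.2 ⟨i, by simp, hi⟩, hvr.mono ?_⟩
    rw [dist_self]
    linarith
  · rintro ⟨k, c, j, hj, v, hv, hvc⟩
    refine ⟨S.a c, ?_, hvc.mem_of_enumerates (by simp) hp (enumerates_of_mem_pre hv)⟩
    rw [Metric.mem_closedBall, dist_comm]
    exact (hj.trans (h.lower j)).le

end IsRadiusApprox

theorem effectivelyLocallyCompactBalls_of_admitsErcs (h : S.rep.AdmitsErcs) :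
    S.EffectivelyLocallyCompactBalls := by
  obtain ⟨U, B, R, h⟩ := h
  -- Indexing the oracles by all names with the point and the real they describe makes the uniform
  -- constructions yield one machine, which sees only the name.
  let ι := {t : (ℕ → ℕ) × X × ℝ // S.rep.rel (fun n => t.1 (2 * n)) t.2.1 ∧
    RepSpace.real.rel (fun n => t.1 (2 * n + 1)) t.2.2 ∧ 0 < t.2.2}
  let o : ι → ℕ → ℕ := fun i => i.1.1
  have hx : OReal o fun i (c : ℕ) => dist i.1.2.1 (S.a c) :=
    oReal_dist_oracle fun i => i.2.1
  have hε : OReal o fun i (_ : Unit) => i.1.2.2 := oReal_oracle fun i => i.2.2.1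
  obtain ⟨σ, hσ, hσs⟩ := exists_radiusApprox hx hε (fun i => i.2.2.2) h
  obtain ⟨qK, hqK, hqKe⟩ := SemiDec.exists_enumeration
    (A := fun i (_ : Unit) z => S.CoverCert B i.1.2.1 (σ i) z)
    (semiDec_coverCert hx h.computable_compacts hσ)
  obtain ⟨qV, hqV, hqVe⟩ := SemiDec.exists_enumeration
    (A := fun i (_ : Unit) z => S.MeetCert i.1.2.1 (σ i) z) (semiDec_meetCert hx hσ)
  have hρ : OComp o fun i j => (σ i (j + 1)).2.1 :=
    (OComp.of_primrec (f := fun y : ℕ × ℕ × ℕ => y.2.1) (by fun_prop)).comp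
      (hσ.comp_primrec (r := fun j => j + 1) (by fun_prop))
  -- The interleavings follow the coding of nested pairs: `𝒦`-name with `𝒱`-name, then the radius.
  obtain ⟨Φ, hΦ, hT⟩ := (OComp.interleave (OComp.interleave
    (hqK.comp_primrec (r := fun c => ((), c)) (by fun_prop))
    (hqV.comp_primrec (r := fun c => ((), c)) (by fun_prop))) hρ).exists_transforms
  refine ⟨Φ, hΦ, ?_⟩
  rintro p ⟨x, ε⟩ ⟨hpx, hpε⟩ hpos
  let i : ι := ⟨(p, x, ε), hpx, hpε, hpos⟩
  obtain ⟨n, ρ, hr⟩ := hσs i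
  have hKrel : ∀ q V, S.rep.opens.rel q V →
      (Metric.closedBall x ρ ⊆ V.1 ↔ ∃ k, Enumerates (qK i ()) (pre q k)) := fun q V hq => by
    simp only [hqKe]
    exact hr.subset_iff hq
  have hVrel : ∀ q V, S.rep.opens.rel q V →
      ((Metric.closedBall x ρ ∩ V.1).Nonempty ↔ ∃ k, Enumerates (qV i ()) (pre q k)) :=
    fun q V hq => by
      simp only [hqVe]
      exact hr.meets_iff hq
  have hcomp : S.rep.IsCompactSet (Metric.closedBall x ρ) := isOpenSet_of_enumerates hKrel
  have hclosed : S.rep.IsClosedSet (Metric.closedBall x ρ) :=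
    isOpenSet_of_isOpen Metric.isClosed_closedBall.isOpen_compl
  refine ⟨_, (⟨Metric.closedBall x ρ, ⟨isSaturated _, hcomp⟩, hclosed⟩, ρ), hT i, ⟨?_, ?_⟩,
    hr.pos, rfl, hr.closedBall_subset.trans hr.subset_ball⟩
  · rw [interleave_even]
    refine ⟨?_, ?_⟩
    · rw [interleave_even]
      exact hKrel
    · rw [interleave_odd]
      exact hVrel
  · rw [interleave_odd]
    exact hr.rel_real

end ComputableMetricStructure

theorem corollary21 {X : Type*} [MetricSpace X] [CompleteSpace X]
    (S : ComputableMetricStructure X) :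
    S.EffectivelyLocallyCompactBalls ↔ S.rep.AdmitsErcs :=
  ⟨fun h => h.admitsErcs,
    ComputableMetricStructure.effectivelyLocallyCompactBalls_of_admitsErcs⟩
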